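/- Theorem. All rings are non-associative, i.e. additive abelian groups with a biadditive multiplication, not assumed associative or unital. Let $G$ be a groupoid (a small category in which every morphism is invertible); write $d(g)$ and $c(g)$ for the domain and codomain of $g\in\mathrm{mor}(G)$, write $gh$ for the composite of $g$ and $h$ when $d(g)=c(h)$, and identify each object with its identity morphism. Let $R$ be an alternative ring, i.e. $(xx)y=x(xy)$ and $x(yy)=(xy)y$ for all $x,y\in R$. Let $\alpha=\{\alpha_g:R_{g^{-1}}\to R_g\}_{g\in\mathrm{mor}(G)}$ be a partial action of $G$ on $R$: for each $g\in\mathrm{mor}(G)$, $R_g$ is a (two-sided) ideal of $R_{c(g)}$, $R_{c(g)}$ is an ideal of $R$, and $\alpha_g$ is a ring isomorphism, such that 1. $\alpha_e=\mathrm{id}_{R_e}$ for every object $e$; 2. $\alpha_h^{-1}(R_h\cap R_{g^{-1}})\subseteq R_{(gh)^{-1}}$ whenever $d(g)=c(h)$; 3. $\alpha_g(\alpha_h(x))=\alpha_{gh}(x)$ whenever $d(g)=c(h)$ and $x\in\alpha_h^{-1}(R_h\cap R_{g^{-1}})$; 4. $R=\bigoplus_{e\in\mathrm{ob}(G)}R_e$.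 Assume that $\alpha$ is unital, i.e. every non-zero $R_g$ has a multiplicative identity. Let $R\star_\alpha G$ be the partial skew groupoid ring: the set of all finite formal sums $\sum_{g\in\mathrm{mor}(G)}r_g\delta_g$ with $r_g\in R_g$, with componentwise addition and the biadditive multiplication determined by $(r\delta_g)(s\delta_h)=\alpha_g(\alpha_{g^{-1}}(r)s)\,\delta_{gh}$ if $d(g)=c(h)$, and $(r\delta_g)(s\delta_h)=0$ otherwise. Call a ring $A$ left (right) artinian if it satisfies the descending chain condition on left (right) ideals, i.e. on additive subgroups $I$ with $AI\subseteq I$ ($IA\subseteq I$). Then $R\star_\alpha G$ is left artinian if and only if $R$ is left artinian and $R_g=\{0\}$ for all but finitely many $g\in\mathrm{mor}(G)$; and $R\star_\alpha G$ is right artinian if and only if $R$ is right artinian and $R_g=\{0\}$ for all but finitely many $g\in\mathrm{mor}(G)$. -/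

import Mathlib

open CategoryTheory

universe v u w

/-! ### Non-associative rings: alternativity and one-sided chain conditions -/

/-- A (not necessarily associative or unital) ring is alternative if `x²y = x(xy)` and
`xy² = (xy)y` for all `x`, `y`. -/
def IsAlternativeRing (A : Type*) [NonUnitalNonAssocRing A] : Prop :=
  ∀ x y : A, (x * x) * y = x * (x * y) ∧ x * (y * y) = (x * y) * y

/-- An additive subgroup `I` is a left ideal, that is, a submodule of the left module `A` over
the non-associative ring `A`. -/
def IsLeftIdeal {A : Type*} [NonUnitalNonAssocRing A] (I : AddSubgroup A) : Prop :=
  ∀ a x : A, x ∈ I → a * x ∈ I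

/-- An additive subgroup `I` is a right ideal, that is, a submodule of the right module `A` over
the non-associative ring `A`. -/
def IsRightIdeal {A : Type*} [NonUnitalNonAssocRing A] (I : AddSubgroup A) : Prop :=
  ∀ a x : A, x ∈ I → x * a ∈ I

/-- Descending chain condition on left ideals. -/
def IsLeftArtinian (A : Type*) [NonUnitalNonAssocRing A] : Prop :=
  ∀ I : ℕ → AddSubgroup A, (∀ n, IsLeftIdeal (I n)) → Antitone I →
    ∃ n, ∀ m, n ≤ m → I m = I n

/-- Descending chain condition on right ideals. -/
def IsRightArtinian (A : Type*) [NonUnitalNonAssocRing A] : Prop :=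
  ∀ I : ℕ → AddSubgroup A, (∀ n, IsRightIdeal (I n)) → Antitone I →
    ∃ n, ∀ m, n ≤ m → I m = I n

/-! ### Partial actions of groupoids on non-associative rings

A morphism `g : a ⟶ b` has domain `d(g) = a` and codomain `c(g) = b`; the product `gh`, for
`d(g) = c(h)`, is `h ≫ g`. An object `e` is identified with its identity morphism `𝟙 e`. -/

open scoped Classical in
/-- A partial action of a groupoid `G` on a non-associative ring `R`, with
`R = ⨁ R_e` over the objects `e` of `G`. Here `D g` is `R_g` and
`α g : R_{g⁻¹} → R_g` is a ring isomorphism. -/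
structure GroupoidPartialAction (G : Type u) [Groupoid.{v} G]
    (R : Type w) [NonUnitalNonAssocRing R] where
  /-- the subring `R_g` -/
  D : ∀ {a b : G}, (a ⟶ b) → NonUnitalSubring R
  /-- the isomorphism `α_g : R_{g⁻¹} → R_g` -/
  α : ∀ {a b : G} (g : a ⟶ b), D (Groupoid.inv g) ≃+* D g
  /-- `R_e` is an ideal of `R` for every object `e` -/
  ideal_obj : ∀ (e : G) (r x : R), x ∈ D (𝟙 e) → r * x ∈ D (𝟙 e) ∧ x * r ∈ D (𝟙 e)
  /-- `R_g` is contained in `R_{c(g)}` -/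
  le_cod : ∀ {a b : G} (g : a ⟶ b), D g ≤ D (𝟙 b)
  /-- `R_g` is an ideal of `R_{c(g)}` -/
  ideal_cod : ∀ {a b : G} (g : a ⟶ b) (r x : R), r ∈ D (𝟙 b) → x ∈ D g →
    r * x ∈ D g ∧ x * r ∈ D g
  /-- `α_e` is the identity of `R_e` for every object `e` -/
  map_id : ∀ (e : G) (x : D (Groupoid.inv (𝟙 e))), (α (𝟙 e) x : R) = x
  /-- `α_h⁻¹(R_h ∩ R_{g⁻¹}) ⊆ R_{(gh)⁻¹}` -/
  dom_comp : ∀ {a b c : G} (h : a ⟶ b) (g : b ⟶ c) (x : D (Groupoid.inv h)),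
    (α h x : R) ∈ D (Groupoid.inv g) → (x : R) ∈ D (Groupoid.inv (h ≫ g))
  /-- `α_g(α_h(x)) = α_{gh}(x)` for `x ∈ α_h⁻¹(R_h ∩ R_{g⁻¹})` -/
  map_comp : ∀ {a b c : G} (h : a ⟶ b) (g : b ⟶ c) (x : D (Groupoid.inv h))
    (hx : (α h x : R) ∈ D (Groupoid.inv g)),
    (α g ⟨α h x, hx⟩ : R) = α (h ≫ g) ⟨x, dom_comp h g x hx⟩
  /-- `R = ⨁ R_e`, the sum over all objects `e` -/
  isInternal : DirectSum.IsInternal (fun e : G => D (𝟙 e))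

namespace GroupoidPartialAction

variable {G : Type u} [Groupoid.{v} G] {R : Type w} [NonUnitalNonAssocRing R]

/-- The partial action is unital if every non-zero `R_g` has a multiplicative identity. -/
def IsUnital (P : GroupoidPartialAction G R) : Prop :=
  ∀ {a b : G} (g : a ⟶ b), P.D g ≠ ⊥ → ∃ u ∈ P.D g, ∀ x ∈ P.D g, u * x = x ∧ x * u = x

variable (P : GroupoidPartialAction G R)

lemma α_congr {a b : G} {g g' : a ⟶ b} (h : g = g') (x : R) (hx : x ∈ P.D (Groupoid.inv g))
    (hx' : x ∈ P.D (Groupoid.inv g')) :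
    (P.α g ⟨x, hx⟩ : R) = P.α g' ⟨x, hx'⟩ := by
  subst h; rfl

lemma mem_inv_inv {a b : G} {g : a ⟶ b} {x : R} (hx : x ∈ P.D g) :
    x ∈ P.D (Groupoid.inv (Groupoid.inv g)) := by
  have : Groupoid.inv (Groupoid.inv g) = g := by simp
  rwa [this]

/-- `α_{g⁻¹}` is the inverse of `α_g`. -/
lemma α_inv {a b : G} (g : a ⟶ b) (r : P.D g) :
    (P.α (Groupoid.inv g) ⟨r, P.mem_inv_inv r.2⟩ : R) = (P.α g).symm r := by
  obtain ⟨x, rfl⟩ := (P.α g).surjective r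
  rw [P.map_comp g (Groupoid.inv g) x (P.mem_inv_inv (P.α g x).2), RingEquiv.symm_apply_apply]
  have e : g ≫ Groupoid.inv g = 𝟙 a := Groupoid.comp_inv g
  have hx : (x : R) ∈ P.D (Groupoid.inv (𝟙 a)) := by
    rw [← e]; exact P.dom_comp g _ x (P.mem_inv_inv (P.α g x).2)
  rw [P.α_congr e x _ hx, P.map_id]

/-- `α_g(R_{g⁻¹} ∩ R_h) ⊆ R_{gh}`. -/
lemma α_mem_comp {a b c : G} (h : a ⟶ b) (g : b ⟶ c) (x : P.D (Groupoid.inv g))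
    (hx : (x : R) ∈ P.D h) : (P.α g x : R) ∈ P.D (h ≫ g) := by
  have key := P.dom_comp (Groupoid.inv g) (Groupoid.inv h)
    ⟨P.α g x, P.mem_inv_inv (P.α g x).2⟩ (by
      rw [P.α_inv, RingEquiv.symm_apply_apply]; exact P.mem_inv_inv hx)
  have e : Groupoid.inv (Groupoid.inv g ≫ Groupoid.inv h) = h ≫ g := by simp
  rwa [e] at key

/-- The product `α_{g⁻¹}(r) s`, an element of `R_{g⁻¹}`, for `r ∈ R_g`, `s ∈ R_h`, `d(g) = c(h)`.
(`(P.α g).symm` is `α_{g⁻¹}`, see `α_inv`.) -/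
def innerMul {a b c : G} (g : b ⟶ c) (h : a ⟶ b) (r : P.D g) (s : P.D h) :
    P.D (Groupoid.inv g) :=
  ⟨(P.α g).symm r * s,
    (P.ideal_cod (Groupoid.inv g) s _ (P.le_cod h s.2) ((P.α g).symm r).2).2⟩

/-- The coefficient `α_g(α_{g⁻¹}(r) s) ∈ R_{gh}` of `(r δ_g)(s δ_h)`, for `d(g) = c(h)`. -/
def coeffMul {a b c : G} (g : b ⟶ c) (h : a ⟶ b) (r : P.D g) (s : P.D h) : P.D (h ≫ g) :=
  ⟨P.α g (P.innerMul g h r s), P.α_mem_comp h g _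
    (P.ideal_cod h _ s (P.le_cod _ ((P.α g).symm r).2) s.2).1⟩

lemma coeffMul_add {a b c : G} (g : b ⟶ c) (h : a ⟶ b) (r : P.D g) (s s' : P.D h) :
    P.coeffMul g h r (s + s') = P.coeffMul g h r s + P.coeffMul g h r s' := by
  have : P.innerMul g h r (s + s') = P.innerMul g h r s + P.innerMul g h r s' :=
    Subtype.ext (by simp [innerMul, mul_add])
  exact Subtype.ext (by simp [coeffMul, this])

lemma add_coeffMul {a b c : G} (g : b ⟶ c) (h : a ⟶ b) (r r' : P.D g) (s : P.D h) :
    P.coeffMul g h (r + r') s = P.coeffMul g h r s + P.coeffMul g h r' s := by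
  have : P.innerMul g h (r + r') s = P.innerMul g h r s + P.innerMul g h r' s :=
    Subtype.ext (by simp [innerMul, add_mul])
  exact Subtype.ext (by simp [coeffMul, this])

/-! ### The partial skew groupoid ring -/

/-- The partial skew groupoid ring `R ⋆_α G`: all finite formal sums `∑ r_g δ_g` with
`r_g ∈ R_g`, where `g` runs over all morphisms of `G`. -/
def SkewRing : Type max u v w :=
  DirectSum (Quiver.Total G) (fun g => P.D g.hom)

noncomputable instance : AddCommGroup P.SkewRing :=
  inferInstanceAs (AddCommGroup (DirectSum (Quiver.Total G) (fun g => P.D g.hom)))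

open scoped Classical in
/-- `δ g r` is the element `r δ_g` of `R ⋆_α G`, for `r ∈ R_g`. -/
noncomputable def δ {a b : G} (g : a ⟶ b) : P.D g →+ P.SkewRing :=
  DirectSum.of (fun g : Quiver.Total G => P.D g.hom) ⟨a, b, g⟩

/-- The biadditive map `(r, s) ↦ (r δ_g)(s δ_h) = α_g(α_{g⁻¹}(r) s) δ_{gh}`, if `d(g) = c(h)`. -/
noncomputable def compMul {a b c : G} (g : b ⟶ c) (h : a ⟶ b) :
    P.D g →+ P.D h →+ P.SkewRing :=
  AddMonoidHom.mk' (fun r => AddMonoidHom.mk' (fun s => P.δ (h ≫ g) (P.coeffMul g h r s))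
      (fun s s' => by rw [coeffMul_add, map_add]))
    (fun r r' => by ext s; simp [add_coeffMul])

open scoped Classical in
/-- The biadditive map `(r, s) ↦ (r δ_g)(s δ_h)` for arbitrary morphisms `g` and `h`: it is zero
if `d(g) ≠ c(h)`. -/
noncomputable def homogMul : ∀ g h : Quiver.Total G,
    P.D g.hom →+ P.D h.hom →+ P.SkewRing
  | ⟨b, _, g⟩, ⟨_, b', h⟩ =>
    if e : b' = b then by subst e; exact P.compMul g h else 0

open scoped Classical in
/-- The biadditive extension of `homogMul`, the multiplication of `R ⋆_α G`. -/
noncomputable def mulHom : P.SkewRing →+ P.SkewRing →+ P.SkewRing :=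
  DirectSum.toAddMonoid (fun g =>
    AddMonoidHom.flip (DirectSum.toAddMonoid (fun h => (P.homogMul g h).flip)))

noncomputable instance : Mul P.SkewRing := ⟨fun x y => P.mulHom x y⟩

noncomputable instance : NonUnitalNonAssocRing P.SkewRing :=
  { (inferInstance : AddCommGroup P.SkewRing), (inferInstance : Mul P.SkewRing) with
    left_distrib := fun x y z => map_add (P.mulHom x) y z
    right_distrib := fun x y z => by
      change P.mulHom (x + y) z = P.mulHom x z + P.mulHom y z
      rw [map_add, AddMonoidHom.add_apply]
    zero_mul := fun x => by
      change P.mulHom 0 x = 0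
      rw [map_zero, AddMonoidHom.zero_apply]
    mul_zero := fun x => map_zero (P.mulHom x) }

/-- `(r δ_g)(s δ_h) = α_g(α_{g⁻¹}(r) s) δ_{gh}` if `d(g) = c(h)`. -/
theorem δ_mul_δ {a b c : G} (g : b ⟶ c) (h : a ⟶ b) (r : P.D g) (s : P.D h) :
    P.δ g r * P.δ h s = P.δ (h ≫ g) (P.coeffMul g h r s) := by
  classical
  change P.mulHom (P.δ g r) (P.δ h s) = _
  simp only [mulHom, δ]
  erw [DirectSum.toAddMonoid_of, AddMonoidHom.flip_apply, DirectSum.toAddMonoid_of]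
  simp [homogMul, compMul, δ]

/-- `(r δ_g)(s δ_h) = 0` if `d(g) ≠ c(h)`. -/
theorem δ_mul_δ_of_ne {a b b' c : G} (g : b ⟶ c) (h : a ⟶ b') (e : b' ≠ b)
    (r : P.D g) (s : P.D h) : P.δ g r * P.δ h s = 0 := by
  classical
  change P.mulHom (P.δ g r) (P.δ h s) = _
  simp only [mulHom, δ]
  erw [DirectSum.toAddMonoid_of, AddMonoidHom.flip_apply, DirectSum.toAddMonoid_of]
  simp [homogMul, e]

end GroupoidPartialAction

/-! Necessity rests on two order embeddings into the left ideals of the skew ring. A left ideal `I`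
of `R` goes to the sum of the `α_g(I ∩ R_{g⁻¹}) δ_g`, and its coefficients at identities recover
`I`; hence `R` is left artinian (`IsUnital.isLeftArtinian_base`).

For finiteness, alternativity makes intersections of unital ideals unital, so distinct minimal
non-zero unital ideals (blocks) meet in zero, and a left artinian `R` has finitely many. Each
non-zero `R_g` contains a block, and `α_g` carries blocks to blocks. If infinitely many `R_g` were
non-zero, infinitely many `g` would move one block `M` to one block `N`, so the stabilizer `H` of
`M` in an isotropy group would be infinite (`IsUnital.exists_infinite_stabilizer`). The identity `u`
of `M` is a non-zero idempotent, so some additive map from `R` to a prime field `k` takes it to 1.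
With it the left ideals of `kH` embed into those of the skew ring, so `kH` is artinian
(`IsUnital.isArtinianRing_monoidAlgebra`). By Connell's theorem `H` is then finite
(`MonoidAlgebra.finite_of_isArtinianRing`), a contradiction.

Conversely, the skew ring is a finite sum of the `R_g δ_g`. Left multiplication by the `r δ_e` acts
on each as on an ideal of `R`, so each summand satisfies the chain condition and so does the sum.

The right-hand statement follows by passing to the opposite ring, since `r δ_g ↦ α_{g⁻¹}(r) δ_{g⁻¹}`
is an anti-isomorphism. -/

/-! ### Left artinian group algebras over a field -/

namespace MonoidAlgebra

variable {k : Type*} {H : Type*} [Field k] [Group H]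

/-- The coefficient at 1 is a trace, because `ab = 1` exactly when `ba = 1`. -/
lemma coeff_one_mul_comm (x y : MonoidAlgebra k H) : (x * y).coeff 1 = (y * x).coeff 1 := by
  classical
  induction x using MonoidAlgebra.induction_linear with
  | zero => simp
  | add a b ha hb => simp [add_mul, mul_add, ha, hb]
  | single a r =>
    induction y using MonoidAlgebra.induction_linear with
    | zero => simp
    | add a b ha hb => simp [add_mul, mul_add, ha, hb]
    | single b s =>
      simp only [single_mul_single, coeff_single, Finsupp.single_apply, mul_comm r s]
      simp only [mul_eq_one_iff_eq_inv (a := a), mul_eq_one_iff_inv_eq (a := b), eq_comm (b := a)]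

/-- The left and the right annihilator of a two-sided ideal of a group algebra agree. -/
lemma mul_eq_zero_of_annihilates_right {J : Ideal (MonoidAlgebra k H)} {x : MonoidAlgebra k H}
    (hx : ∀ j ∈ J, x * j = 0) {j : MonoidAlgebra k H} (hj : j ∈ J) : j * x = 0 := by
  ext g
  have h1 : (single g⁻¹ 1 * (j * x)).coeff 1 = (j * x).coeff g := by
    have := coeff_single_mul_eq_mul_coeff (m := g⁻¹) (m₁ := 1) (r := (1 : k)) (x := j * x) g
      (fun m' _ => by rw [inv_mul_eq_one, eq_comm])
    rwa [one_mul] at this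
  -- By the trace property this coefficient equals that of `x (g⁻¹ j)` at 1, and `g⁻¹ j ∈ J`.
  rw [← h1, ← mul_assoc, coeff_one_mul_comm, hx _ (J.mul_mem_left _ hj), coeff_zero,
    Finsupp.zero_apply, Finsupp.zero_apply]

/-- The augmentation map of a group algebra. -/
noncomputable def augmentation (k H : Type*) [Field k] [Group H] : MonoidAlgebra k H →ₐ[k] k :=
  MonoidAlgebra.lift k k H 1

lemma augmentation_single (g : H) (r : k) : augmentation k H (single g r) = r := by
  simp [augmentation]

/-- In the group algebra of an infinite group, only zero is annihilated by the augmentation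
ideal. -/
lemma eq_zero_of_augmentation_mul_eq_zero [Infinite H] {x : MonoidAlgebra k H}
    (hx : ∀ w, augmentation k H w = 0 → w * x = 0) : x = 0 := by
  by_contra hne
  -- Annihilation by `g⁻¹ - 1` makes the coefficients of `x` invariant under left translation, hence
  -- constant, which finite support forbids on an infinite group.
  have key : ∀ g h : H, x.coeff (g * h) = x.coeff h := by
    intro g h
    have h1 := hx (single g⁻¹ 1 - 1) (by
      rw [map_sub, augmentation_single, map_one, sub_self])
    rw [sub_mul, one_mul, sub_eq_zero] at h1
    have h2 := coeff_single_mul_eq_mul_coeff (m := g⁻¹) (m₁ := h) (r := (1 : k)) (x := x) (g * h)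
      (fun m' _ => by rw [inv_mul_eq_iff_eq_mul])
    rw [h1, one_mul] at h2
    exact h2.symm
  obtain ⟨h, hh⟩ : ∃ h, x.coeff h ≠ 0 := by
    by_contra! hc
    exact hne (by ext g; simpa using hc g)
  have : (Set.univ : Set H) ⊆ x.coeff.support := fun g _ => by
    have := key (g * h⁻¹) h
    rw [inv_mul_cancel_right] at this
    simpa [this] using hh
  exact Set.infinite_univ ((Finset.finite_toSet _).subset this)

/-- Modulo the nilpotent radical `J` the augmentation ideal `ω` is generated by an idempotent, which
lifts to `f` with `ω(1 - f) ⊆ J`. At the last power of `J` not killed by `1 - f` there is a non-zero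
`(1 - f)z` with `(1 - f)zJ = 0`. Trace symmetry gives `J(1 - f)z = 0`, so `ω` annihilates `(1 -
f)z`, which is impossible for infinite `H`. -/
theorem finite_of_isArtinianRing [IsArtinianRing (MonoidAlgebra k H)] : Finite H := by
  by_contra hfin
  rw [not_finite_iff_infinite] at hfin
  set A := MonoidAlgebra k H
  let J : Ideal A := Ring.jacobson A
  obtain ⟨n, hn⟩ : IsNilpotent J := IsSemiprimaryRing.isNilpotent
  have hJnil : ∀ x ∈ J, IsNilpotent x := fun x hx =>
    ⟨n, by simpa [hn] using Ideal.pow_mem_pow hx n⟩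
  let π : A →+* A ⧸ J := Ideal.Quotient.mk J
  have hπ : ∀ x, π x = 0 ↔ x ∈ J := fun x => Ideal.Quotient.eq_zero_iff_mem
  have hπs : Function.Surjective π := Ideal.Quotient.mk_surjective
  let ε := augmentation k H
  have hJε : ∀ x ∈ J, ε x = 0 := fun x hx => by
    have := (hJnil x hx).map ε
    exact this.eq_zero
  obtain ⟨e, he, hspan⟩ := IsSemisimpleRing.ideal_eq_span_idempotent
    (Ideal.map π (RingHom.ker ε))
  obtain ⟨f, hf, rfl⟩ := exists_isIdempotentElem_eq_of_ker_isNilpotent π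
    (fun x hx => hJnil x ((hπ x).1 hx)) e (hπs e) he
  have hfε : ε f = 0 := by
    have h1 : π f ∈ Ideal.map π (RingHom.ker ε) := by
      rw [hspan]; exact Ideal.mem_span_singleton_self _
    obtain ⟨w, hw, hwf⟩ := (Ideal.mem_map_iff_of_surjective π hπs).1 h1
    have h2 : f - w ∈ J := (hπ _).1 (by rw [map_sub, hwf, sub_self])
    have h3 := hJε _ h2
    rw [map_sub, show ε w = 0 from hw, sub_zero] at h3
    exact h3
  have hωf : ∀ w, ε w = 0 → w * (1 - f) ∈ J := by
    intro w hw
    have h1 : π w ∈ Ideal.map π (RingHom.ker ε) := Ideal.mem_map_of_mem π hw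
    rw [hspan, Ideal.mem_span_singleton'] at h1
    obtain ⟨a, ha⟩ := h1
    rw [← hπ, map_mul, map_sub, map_one, ← ha, mul_sub, mul_one, mul_assoc, he.eq, sub_self]
  have hex : ∃ m, ∀ z ∈ J ^ m, (1 - f) * z = 0 := ⟨n, fun z hz => by
    rw [hn] at hz; rw [show z = 0 from hz, mul_zero]⟩
  classical
  obtain ⟨m, hm, hmin⟩ : ∃ m, (∀ z ∈ J ^ m, (1 - f) * z = 0) ∧
      ∀ l < m, ¬ ∀ z ∈ J ^ l, (1 - f) * z = 0 :=
    ⟨Nat.find hex, Nat.find_spec hex, fun l hl => Nat.find_min hex hl⟩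
  cases m with
  | zero =>
    -- Exponent zero would force `f = 1`, against `ε f = 0`.
    have h1 := hm 1 (by rw [Submodule.pow_zero, Ideal.one_eq_top]; trivial)
    rw [mul_one, sub_eq_zero] at h1
    have := congrArg ε h1
    rw [map_one, hfε] at this
    exact one_ne_zero this
  | succ l =>
    have h1 := hmin l (Nat.lt_succ_self l)
    push Not at h1
    obtain ⟨z, hz, hzne⟩ := h1
    refine hzne (eq_zero_of_augmentation_mul_eq_zero fun w hw => ?_)
    have h2 : ∀ j ∈ J, (1 - f) * z * j = 0 := fun j hj => by
      rw [mul_assoc]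
      exact hm _ (by rw [Submodule.pow_succ]; exact Ideal.mul_mem_mul hz hj)
    have h3 := mul_eq_zero_of_annihilates_right h2 (hωf w hw)
    rwa [← mul_assoc, mul_assoc w, hf.one_sub.eq, mul_assoc] at h3

end MonoidAlgebra

/-! ### Unital ideals of alternative rings -/

section UnitalIdeal

variable {A : Type*} [NonUnitalNonAssocRing A]

/-- A unital ideal of a non-associative ring: a two-sided ideal having a multiplicative
identity. -/
def IsUnitalIdeal (I : AddSubgroup A) : Prop :=
  (∀ r x : A, x ∈ I → r * x ∈ I ∧ x * r ∈ I) ∧ ∃ u ∈ I, ∀ x ∈ I, u * x = x ∧ x * u = x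

lemma IsUnitalIdeal.isLeftIdeal {I : AddSubgroup A} (hI : IsUnitalIdeal I) : IsLeftIdeal I :=
  fun a x hx => (hI.1 a x hx).1

/-- In an alternative ring the associator is invariant under cyclic permutations. -/
lemma IsAlternativeRing.associator_cyclic (hA : IsAlternativeRing A) (x y z : A) :
    (x * y) * z - x * (y * z) = (y * z) * x - y * (z * x) := by
  have h1 := (hA (x + y) z).1
  have h2 := (hA x z).1
  have h3 := (hA y z).1
  have h4 := (hA y (x + z)).2
  have h5 := (hA y x).2
  have h6 := (hA y z).2
  simp only [add_mul, mul_add] at h1 h4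
  rw [h2, h3] at h1
  rw [h5, h6] at h4
  have e1 : x * y * z + y * x * z = x * (y * z) + y * (x * z) := by
    rw [← sub_eq_zero, ← sub_eq_zero.2 h1]
    abel
  have e2 : y * (x * z) + y * (z * x) = y * x * z + y * z * x := by
    rw [← sub_eq_zero, ← sub_eq_zero.2 h4]
    abel
  have e3 : x * y * z - x * (y * z) = y * (x * z) - y * x * z := by
    rw [sub_eq_sub_iff_add_eq_add, e1, add_comm]
  rw [e3, sub_eq_sub_iff_add_eq_add, e2, add_comm]

/-- The identity of a unital ideal associates with every element in front of the ideal. -/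
lemma IsAlternativeRing.mul_unit_mul (hA : IsAlternativeRing A) {I : AddSubgroup A} {u : A}
    (hI : ∀ r x : A, x ∈ I → r * x ∈ I ∧ x * r ∈ I)
    (hu : ∀ x ∈ I, u * x = x ∧ x * u = x) (r : A) {x : A} (hx : x ∈ I) :
    (r * u) * x = r * x := by
  have h := hA.associator_cyclic r u x
  rw [(hu x hx).1, (hu _ (hI r x hx).2).1, sub_self] at h
  exact sub_eq_zero.1 h

/-- Two cyclic shifts turn the associator of `x, u, r` into that of `r, x, u`, which vanishes
because `u` fixes both `x` and `r x`. -/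
lemma IsAlternativeRing.mul_mul_unit (hA : IsAlternativeRing A) {I : AddSubgroup A} {u : A}
    (hI : ∀ r x : A, x ∈ I → r * x ∈ I ∧ x * r ∈ I)
    (hu : ∀ x ∈ I, u * x = x ∧ x * u = x) (r : A) {x : A} (hx : x ∈ I) :
    x * (u * r) = x * r := by
  have h := hA.associator_cyclic x u r
  rw [hA.associator_cyclic u r x, (hu x hx).2, (hu _ (hI r x hx).1).2, sub_self] at h
  exact (sub_eq_zero.1 h).symm

/-- The product `u v` of the two identities serves: alternativity gives `(u v) x = u x` for `x ∈ J`
and `x (u v) = x v` for `x ∈ I`. -/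
lemma IsUnitalIdeal.inf (hA : IsAlternativeRing A) {I J : AddSubgroup A} (hI : IsUnitalIdeal I)
    (hJ : IsUnitalIdeal J) : IsUnitalIdeal (I ⊓ J) := by
  obtain ⟨hI, u, hu, hIu⟩ := hI
  obtain ⟨hJ, v, hv, hJv⟩ := hJ
  refine ⟨fun r x hx => ⟨⟨(hI r x hx.1).1, (hJ r x hx.2).1⟩, ⟨(hI r x hx.1).2, (hJ r x hx.2).2⟩⟩,
    u * v, ⟨(hI v u hu).2, (hJ u v hv).1⟩, fun x hx => ⟨?_, ?_⟩⟩
  · rw [hA.mul_unit_mul hJ hJv u hx.2, (hIu x hx.1).1]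
  · rw [hA.mul_mul_unit hI hIu v hx.1, (hJv x hx.2).2]

/-- A block: a minimal non-zero unital ideal. -/
def IsBlock (M : AddSubgroup A) : Prop :=
  IsUnitalIdeal M ∧ M ≠ ⊥ ∧ ∀ N : AddSubgroup A, IsUnitalIdeal N → N ≤ M → N ≠ ⊥ → N = M

lemma IsBlock.inf_eq_bot (hA : IsAlternativeRing A) {M N : AddSubgroup A} (hM : IsBlock M)
    (hN : IsBlock N) (hne : M ≠ N) : M ⊓ N = ⊥ := by
  by_contra h
  have hu := hM.1.inf hA hN.1
  exact hne ((hM.2.2 _ hu inf_le_left h).symm.trans (hN.2.2 _ hu inf_le_right h))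

lemma IsLeftArtinian.exists_minimal (hA : IsLeftArtinian A) {p : AddSubgroup A → Prop}
    (hp : ∀ I, p I → IsLeftIdeal I) {I : AddSubgroup A} (hI : p I) :
    ∃ J ≤ I, p J ∧ ∀ K, p K → K ≤ J → K = J := by
  by_contra! hc
  choose! f hfp hfle hfne using hc
  let s : ℕ → {J : AddSubgroup A // J ≤ I ∧ p J} := fun n =>
    Nat.rec ⟨I, le_rfl, hI⟩ (fun _ J => ⟨f J.1, (hfle _ J.2.1 J.2.2).trans J.2.1,
      hfp _ J.2.1 J.2.2⟩) n
  obtain ⟨n, hn⟩ := hA (fun n => (s n).1) (fun n => hp _ (s n).2.2)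
    (antitone_nat_of_succ_le fun n => hfle _ (s n).2.1 (s n).2.2)
  exact hfne _ (s n).2.1 (s n).2.2 (hn (n + 1) n.le_succ)

lemma IsLeftArtinian.exists_isBlock_le (hA : IsLeftArtinian A) {I : AddSubgroup A}
    (hI : IsUnitalIdeal I) (hne : I ≠ ⊥) : ∃ M ≤ I, IsBlock M := by
  obtain ⟨M, hMI, hM, hmin⟩ := hA.exists_minimal
    (p := fun J => IsUnitalIdeal J ∧ J ≠ ⊥) (fun J hJ => hJ.1.isLeftIdeal) ⟨hI, hne⟩
  exact ⟨M, hMI, hM.1, hM.2, fun N hN hle hN0 => hmin N ⟨hN, hN0⟩ hle⟩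

lemma IsLeftIdeal.iSup {ι : Sort*} {I : ι → AddSubgroup A} (hI : ∀ i, IsLeftIdeal (I i)) :
    IsLeftIdeal (⨆ i, I i) := by
  intro a x hx
  induction hx using AddSubgroup.iSup_induction' with
  | hp i x hx => exact AddSubgroup.mem_iSup_of_mem i (hI i a x hx)
  | h1 => rw [mul_zero]; exact zero_mem _
  | hadd x y _ _ hx hy => rw [mul_add]; exact add_mem hx hy

/-- A left artinian alternative ring has only finitely many blocks. -/
lemma IsLeftArtinian.finite_setOf_isBlock (hA : IsAlternativeRing A) (h : IsLeftArtinian A) :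
    {M : AddSubgroup A | IsBlock M}.Finite := by
  by_contra hinf
  obtain ⟨M, hMinj, hM⟩ : ∃ M : ℕ → AddSubgroup A, Function.Injective M ∧ ∀ n, IsBlock (M n) :=
    ⟨fun n => Set.Infinite.natEmbedding _ hinf n,
      Subtype.val_injective.comp (Set.Infinite.natEmbedding _ hinf).injective,
      fun n => (Set.Infinite.natEmbedding _ hinf n).2⟩
  -- Tails of the sum of the blocks stabilize, so the identity `u` of `M n` lies in the tail from `n
  -- + 1` on; but `u` annihilates that tail, as distinct blocks meet in zero.
  obtain ⟨n, hn⟩ := h (fun n => ⨆ m : {m // n ≤ m}, M m)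
    (fun n => IsLeftIdeal.iSup fun m => (hM m).1.isLeftIdeal)
    (fun i j hij => iSup_le fun m =>
      le_iSup (fun m : {m // i ≤ m} => M m) ⟨m.1, hij.trans m.2⟩)
  obtain ⟨hI, u, hu, hunit⟩ := (hM n).1
  have hmem : u ∈ ⨆ m : {m // n + 1 ≤ m}, M m := by
    rw [hn (n + 1) n.le_succ]
    exact AddSubgroup.mem_iSup_of_mem (⟨n, le_rfl⟩ : {m // n ≤ m}) hu
  have hle : (⨆ m : {m // n + 1 ≤ m}, M m) ≤ (AddMonoidHom.mulLeft u).ker := by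
    refine iSup_le fun m x hx => ?_
    have hne : M n ≠ M m := fun h => by have := hMinj h; have := m.2; omega
    have h0 : u * x ∈ M n ⊓ M m := ⟨(hI x u hu).2, ((hM m).1.1 u x hx).1⟩
    rw [(hM n).inf_eq_bot hA (hM m) hne] at h0
    exact h0
  have hu0 : u = 0 := (hunit u hu).1.symm.trans (hle hmem)
  refine (hM n).2.1 ((AddSubgroup.eq_bot_iff_forall _).2 fun x hx => ?_)
  rw [← (hunit x hx).1, hu0, zero_mul]

end UnitalIdeal

/-! ### Calculus of homogeneous elements -/

namespace GroupoidPartialAction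

variable {G : Type u} [Groupoid.{v} G] {R : Type w} [NonUnitalNonAssocRing R]
variable (P : GroupoidPartialAction G R)

open scoped Classical in
/-- The partially defined map `α_g`, extended by zero to all of `R`. -/
noncomputable def act {a b : G} (g : a ⟶ b) (x : R) : R :=
  if hx : x ∈ P.D (Groupoid.inv g) then P.α g ⟨x, hx⟩ else 0

open scoped Classical in
/-- The element `x δ_g` of the partial skew groupoid ring, for `x ∈ R_g`, and zero for other `x`. -/
noncomputable def homog {a b : G} (g : a ⟶ b) (x : R) : P.SkewRing :=
  if hx : x ∈ P.D g then P.δ g ⟨x, hx⟩ else 0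

variable {P}

lemma act_of_mem {a b : G} {g : a ⟶ b} {x : R} (hx : x ∈ P.D (Groupoid.inv g)) :
    P.act g x = P.α g ⟨x, hx⟩ := dif_pos hx

lemma homog_of_mem {a b : G} {g : a ⟶ b} {x : R} (hx : x ∈ P.D g) :
    P.homog g x = P.δ g ⟨x, hx⟩ := dif_pos hx

variable {a b c d : G}

lemma act_mem {g : a ⟶ b} {x : R} (hx : x ∈ P.D (Groupoid.inv g)) : P.act g x ∈ P.D g := by
  rw [act_of_mem hx]; exact Subtype.property _

lemma act_inv_mem {g : a ⟶ b} {x : R} (hx : x ∈ P.D g) :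
    P.act (Groupoid.inv g) x ∈ P.D (Groupoid.inv g) :=
  act_mem (P.mem_inv_inv hx)

lemma act_add {g : a ⟶ b} {x y : R} (hx : x ∈ P.D (Groupoid.inv g))
    (hy : y ∈ P.D (Groupoid.inv g)) : P.act g (x + y) = P.act g x + P.act g y := by
  rw [act_of_mem hx, act_of_mem hy, act_of_mem (add_mem hx hy)]
  exact congrArg Subtype.val (map_add (P.α g) ⟨x, hx⟩ ⟨y, hy⟩)

lemma act_mul {g : a ⟶ b} {x y : R} (hx : x ∈ P.D (Groupoid.inv g))
    (hy : y ∈ P.D (Groupoid.inv g)) : P.act g (x * y) = P.act g x * P.act g y := by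
  rw [act_of_mem hx, act_of_mem hy, act_of_mem (mul_mem hx hy)]
  exact congrArg Subtype.val (map_mul (P.α g) ⟨x, hx⟩ ⟨y, hy⟩)

lemma act_zero (g : a ⟶ b) : P.act g 0 = 0 := by
  rw [act_of_mem (zero_mem _)]
  exact congrArg Subtype.val (map_zero (P.α g))

lemma act_neg {g : a ⟶ b} {x : R} (hx : x ∈ P.D (Groupoid.inv g)) :
    P.act g (-x) = -P.act g x := by
  rw [act_of_mem hx, act_of_mem (neg_mem hx)]
  exact congrArg Subtype.val (map_neg (P.α g) ⟨x, hx⟩)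

lemma mem_inv_id {e : G} {x : R} : x ∈ P.D (Groupoid.inv (𝟙 e)) ↔ x ∈ P.D (𝟙 e) := by
  have : Groupoid.inv (𝟙 e) = 𝟙 e := by simp
  rw [this]

lemma act_id {e : G} {x : R} (hx : x ∈ P.D (𝟙 e)) : P.act (𝟙 e) x = x := by
  rw [act_of_mem (mem_inv_id.2 hx)]
  exact P.map_id e _

lemma mem_inv_comp {h : a ⟶ b} {g : b ⟶ c} {x : R} (hx : x ∈ P.D (Groupoid.inv h))
    (hx' : P.act h x ∈ P.D (Groupoid.inv g)) : x ∈ P.D (Groupoid.inv (h ≫ g)) := by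
  rw [act_of_mem hx] at hx'
  exact P.dom_comp h g ⟨x, hx⟩ hx'

lemma act_act {h : a ⟶ b} {g : b ⟶ c} {x : R} (hx : x ∈ P.D (Groupoid.inv h))
    (hx' : P.act h x ∈ P.D (Groupoid.inv g)) : P.act g (P.act h x) = P.act (h ≫ g) x := by
  rw [act_of_mem hx', act_of_mem (mem_inv_comp hx hx')]
  rw [act_of_mem hx] at hx'
  rw [← P.map_comp h g ⟨x, hx⟩ hx']
  congr 2
  exact Subtype.ext (act_of_mem hx)

lemma act_inv_act {g : a ⟶ b} {x : R} (hx : x ∈ P.D (Groupoid.inv g)) :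
    P.act (Groupoid.inv g) (P.act g x) = x := by
  have h := P.mem_inv_inv (act_mem hx)
  rw [act_act hx h, Groupoid.comp_inv]
  exact act_id (by simpa using (P.le_cod _ hx))

lemma act_act_inv {g : a ⟶ b} {x : R} (hx : x ∈ P.D g) :
    P.act g (P.act (Groupoid.inv g) x) = x := by
  have h := act_inv_mem hx
  rw [act_act (P.mem_inv_inv hx) h, Groupoid.inv_comp]
  exact act_id (P.le_cod _ hx)

lemma act_inv {g : a ⟶ b} {x : R} (hx : x ∈ P.D g) :
    P.act (Groupoid.inv g) x = (P.α g).symm ⟨x, hx⟩ := by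
  rw [act_of_mem (P.mem_inv_inv hx)]
  exact P.α_inv g ⟨x, hx⟩

lemma act_mem_comp {h : a ⟶ b} {g : b ⟶ c} {x : R} (hx : x ∈ P.D (Groupoid.inv g))
    (hx' : x ∈ P.D h) : P.act g x ∈ P.D (h ≫ g) := by
  rw [act_of_mem hx]
  exact P.α_mem_comp h g ⟨x, hx⟩ hx'

lemma homog_add {g : a ⟶ b} {x y : R} (hx : x ∈ P.D g) (hy : y ∈ P.D g) :
    P.homog g (x + y) = P.homog g x + P.homog g y := by
  rw [homog_of_mem hx, homog_of_mem hy, homog_of_mem (add_mem hx hy), ← map_add]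
  rfl

lemma homog_zero (g : a ⟶ b) : P.homog g 0 = 0 := by
  rw [homog_of_mem (zero_mem _)]
  exact map_zero (P.δ g)

lemma homog_mul_homog {g : b ⟶ c} {h : a ⟶ b} {x y : R} (hx : x ∈ P.D g) (hy : y ∈ P.D h) :
    P.homog g x * P.homog h y = P.homog (h ≫ g) (P.act g (P.act (Groupoid.inv g) x * y)) := by
  have hm : P.act g (P.act (Groupoid.inv g) x * y) =
      P.coeffMul g h ⟨x, hx⟩ ⟨y, hy⟩ := by
    rw [act_inv hx]
    exact act_of_mem (P.innerMul g h ⟨x, hx⟩ ⟨y, hy⟩).2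
  rw [homog_of_mem hx, homog_of_mem hy, P.δ_mul_δ, hm, homog_of_mem (Subtype.property _)]

lemma homog_mul_homog_of_ne {b' : G} {g : b ⟶ c} {h : a ⟶ b'} (hb : b' ≠ b) (x y : R) :
    P.homog g x * P.homog h y = 0 := by
  unfold homog
  split_ifs
  · exact P.δ_mul_δ_of_ne g h hb _ _
  all_goals simp

variable (P) in
/-- The partial skew groupoid ring is additively generated by its homogeneous elements. -/
lemma SkewRing.induction {motive : P.SkewRing → Prop} (s : P.SkewRing) (zero : motive 0)
    (add : ∀ s t, motive s → motive t → motive (s + t))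
    (homog : ∀ {a b : G} (g : a ⟶ b) (x : R), x ∈ P.D g → motive (P.homog g x)) : motive s := by
  classical
  refine DirectSum.induction_on (motive := motive) s zero ?_ add
  rintro ⟨a, b, g⟩ x
  have := homog g x x.2
  rwa [homog_of_mem x.2] at this

open scoped Classical in
variable (P) in
/-- The coefficient of `δ_g` as an additive map into `R`. -/
noncomputable def coeff {a b : G} (g : a ⟶ b) : P.SkewRing →+ R :=
  (P.D g).toAddSubgroup.subtype.comp
    (DFinsupp.evalAddMonoidHom (β := fun g : Quiver.Total G => P.D g.hom) ⟨a, b, g⟩)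

lemma coeff_homog {g : a ⟶ b} {x : R} (hx : x ∈ P.D g) : P.coeff g (P.homog g x) = x := by
  classical
  rw [homog_of_mem hx]
  exact congrArg Subtype.val (DirectSum.of_eq_same (β := fun g : Quiver.Total G => P.D g.hom)
    ⟨a, b, g⟩ ⟨x, hx⟩)

lemma coeff_homog_of_ne {a' b' : G} {g : a ⟶ b} {h : a' ⟶ b'}
    (hne : (⟨a', b', h⟩ : Quiver.Total G) ≠ ⟨a, b, g⟩) (x : R) : P.coeff g (P.homog h x) = 0 := by
  classical
  unfold homog
  split_ifs with hx
  · exact congrArg Subtype.val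
      (DirectSum.of_eq_of_ne (β := fun g : Quiver.Total G => P.D g.hom) _ _ ⟨x, hx⟩ hne.symm)
  · exact map_zero _

/-- An additive map out of the partial skew groupoid ring, from its values on homogeneous
elements. -/
noncomputable def liftHomog {M : Type*} [AddCommMonoid M]
    (f : ∀ g : Quiver.Total G, P.D g.hom →+ M) : P.SkewRing →+ M := by
  classical
  exact DirectSum.toAddMonoid f

lemma liftHomog_homog {M : Type*} [AddCommMonoid M] (f : ∀ g : Quiver.Total G, P.D g.hom →+ M)
    {g : a ⟶ b} {x : R} (hx : x ∈ P.D g) :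
    liftHomog f (P.homog g x) = f ⟨a, b, g⟩ ⟨x, hx⟩ := by
  classical
  rw [homog_of_mem hx]
  exact DirectSum.toAddMonoid_of f ⟨a, b, g⟩ ⟨x, hx⟩

end GroupoidPartialAction

/-! ### Left ideals of the skew ring induced from `R` -/

namespace GroupoidPartialAction

variable {G : Type u} [Groupoid.{v} G] {R : Type w} [NonUnitalNonAssocRing R]
variable {P : GroupoidPartialAction G R} {a b c d : G}

lemma IsUnital.exists_unit (hP : P.IsUnital) (g : a ⟶ b) :
    ∃ u ∈ P.D g, ∀ x ∈ P.D g, u * x = x ∧ x * u = x := by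
  by_cases h : P.D g = ⊥
  · refine ⟨0, zero_mem _, fun x hx => ?_⟩
    rw [h, NonUnitalSubring.mem_bot] at hx
    simp [hx]
  · exact hP g h

lemma IsUnital.isUnitalIdeal (hP : P.IsUnital) (hR : IsAlternativeRing R) (g : a ⟶ b) :
    IsUnitalIdeal (P.D g).toAddSubgroup := by
  refine ⟨fun r x hx => ?_, hP.exists_unit g⟩
  obtain ⟨u, hu, hunit⟩ := hP.exists_unit (𝟙 b)
  have hI := P.ideal_obj b
  have hx' : x ∈ P.D (𝟙 b) := P.le_cod g hx
  constructor
  · rw [← hR.mul_unit_mul (I := (P.D (𝟙 b)).toAddSubgroup) hI hunit r hx']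
    exact (P.ideal_cod g _ x (hI r u hu).1 hx).1
  · rw [← hR.mul_mul_unit (I := (P.D (𝟙 b)).toAddSubgroup) hI hunit r hx']
    exact (P.ideal_cod g _ x (hI r u hu).2 hx).2

/-- Left multiplication of an element of the form `α_g(x) δ_{gh}` by a homogeneous element
amounts to left multiplication of `x` by an element independent of `x` and `h`. -/
lemma IsUnital.exists_homog_mul (hP : P.IsUnital) (hR : IsAlternativeRing R) (g : b ⟶ c)
    (t : c ⟶ d) {r : R} (hr : r ∈ P.D t) :
    ∃ q : R, ∀ {a : G} (h : a ⟶ b) (x : R), x ∈ P.D (Groupoid.inv g) → x ∈ P.D h →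
      q * x ∈ P.D (Groupoid.inv (g ≫ t)) ∧
      P.homog t r * P.homog (h ≫ g) (P.act g x) =
        P.homog (h ≫ g ≫ t) (P.act (g ≫ t) (q * x)) := by
  obtain ⟨u, hu, hunit⟩ := hP.exists_unit g
  have hD {a b : G} (g : a ⟶ b) := (hP.isUnitalIdeal hR g).1
  set r' := P.act (Groupoid.inv t) r with hr'
  have hr'm : r' ∈ P.D (Groupoid.inv t) := act_inv_mem hr
  have hru : r' * u ∈ P.D g := (hD g r' u hu).1
  -- Here `r'` need not lie in `R_g`, so `α_{g⁻¹}` is applied to `r' u` instead; alternativity gives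
  -- `(r' u) y = r' y` for `y ∈ R_g`.
  refine ⟨P.act (Groupoid.inv g) (r' * u), fun h x hx hxh => ?_⟩
  have hq := act_inv_mem hru
  have hact : P.act g (P.act (Groupoid.inv g) (r' * u) * x) = r' * P.act g x := by
    rw [act_mul hq hx, act_act_inv hru]
    exact hR.mul_unit_mul (I := (P.D g).toAddSubgroup) (hD g) hunit r' (act_mem hx)
  have hqx : P.act (Groupoid.inv g) (r' * u) * x ∈ P.D (Groupoid.inv g) := mul_mem hq hx
  have hmem : P.act g (P.act (Groupoid.inv g) (r' * u) * x) ∈ P.D (Groupoid.inv t) := by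
    rw [hact]
    exact (hD (Groupoid.inv t) (P.act g x) r' hr'm).2
  refine ⟨mem_inv_comp hqx hmem, ?_⟩
  rw [homog_mul_homog hr (act_mem_comp hx hxh), ← hr', ← hact, act_act hqx hmem,
    Category.assoc]

lemma isLeftIdeal_closure {X : Set P.SkewRing}
    (hX : ∀ {a b : G} (t : a ⟶ b) (r : R), r ∈ P.D t → ∀ s ∈ X,
      P.homog t r * s ∈ AddSubgroup.closure X) :
    IsLeftIdeal (AddSubgroup.closure X) := by
  intro y s hs
  induction y using SkewRing.induction with
  | zero => rw [zero_mul]; exact zero_mem _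
  | add y z hy hz => rw [add_mul]; exact add_mem hy hz
  | homog t r hr =>
    induction hs using AddSubgroup.closure_induction with
    | mem s hs => exact hX t r hr s hs
    | zero => rw [mul_zero]; exact zero_mem _
    | add y z _ _ hy hz => rw [mul_add]; exact add_mem hy hz
    | neg y _ hy => rw [mul_neg]; exact neg_mem hy

lemma eq_zero_of_mem_of_mem {e f : G} (hne : e ≠ f) {x : R} (he : x ∈ P.D (𝟙 e))
    (hf : x ∈ P.D (𝟙 f)) : x = 0 := by
  classical
  have h := P.isInternal.1 (a₁ := DirectSum.of (fun e : G => P.D (𝟙 e)) e ⟨x, he⟩)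
    (a₂ := DirectSum.of (fun e : G => P.D (𝟙 e)) f ⟨x, hf⟩) (by
      rw [DirectSum.coeAddMonoidHom_of, DirectSum.coeAddMonoidHom_of])
  have h1 := congrArg (fun z : DirectSum G (fun e : G => P.D (𝟙 e)) => (z e : R)) h
  simpa [DirectSum.of_eq_same, DirectSum.of_eq_of_ne _ _ _ hne] using h1

/-- Elements of `R` are sums of elements of the `R_e`. -/
lemma mem_of_forall_mem_obj {I : AddSubgroup R} (h : ∀ e, (P.D (𝟙 e)).toAddSubgroup ≤ I) (x : R) :
    x ∈ I := by
  classical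
  obtain ⟨z, rfl⟩ := P.isInternal.2 x
  induction z using DirectSum.induction_on with
  | zero => rw [map_zero]; exact zero_mem _
  | of e y => rw [DirectSum.coeAddMonoidHom_of]; exact h e y.2
  | add y z hy hz => rw [map_add]; exact add_mem hy hz

/-- Left multiplication by the identity of `R_e` is the projection of `R` onto `R_e`, so a left
ideal is the sum of its intersections with the `R_e`. -/
lemma IsUnital.le_of_forall_obj (hP : P.IsUnital) {I I' : AddSubgroup R} (hI : IsLeftIdeal I)
    (h : ∀ (e : G) (x : R), x ∈ I → x ∈ P.D (𝟙 e) → x ∈ I') : I ≤ I' := by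
  classical
  intro x hx
  obtain ⟨z, rfl⟩ := P.isInternal.2 x
  have key : ∀ e : G, ∃ u : R, ∀ z : DirectSum G (fun e : G => P.D (𝟙 e)),
      u * DirectSum.coeAddMonoidHom (fun e : G => P.D (𝟙 e)) z = z e := by
    intro e
    obtain ⟨u, hu, hunit⟩ := hP.exists_unit (𝟙 e)
    refine ⟨u, fun z => ?_⟩
    induction z using DirectSum.induction_on with
    | zero => simp
    | of f y =>
      rw [DirectSum.coeAddMonoidHom_of]
      by_cases hef : e = f
      · subst hef
        rw [DirectSum.of_eq_same]; exact (hunit y y.2).1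
      · rw [DirectSum.of_eq_of_ne _ _ _ hef]
        exact eq_zero_of_mem_of_mem hef (P.ideal_obj e _ _ hu).2 (P.ideal_obj f _ _ y.2).1
    | add y z hy hz => rw [map_add, mul_add, hy, hz]; rfl
  rw [← DirectSum.sum_support_of z, map_sum]
  refine sum_mem fun e _ => ?_
  rw [DirectSum.coeAddMonoidHom_of]
  obtain ⟨u, hu⟩ := key e
  exact h e _ (hu z ▸ hI u _ hx) (z e).2

variable (P) in
/-- The left ideal of the partial skew groupoid ring generated by a left ideal of `R`. -/
noncomputable def inducedIdeal (I : AddSubgroup R) : AddSubgroup P.SkewRing :=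
  AddSubgroup.closure {s | ∃ (b c : G) (g : b ⟶ c) (x : R), x ∈ I ∧ x ∈ P.D (Groupoid.inv g) ∧
    s = P.homog g (P.act g x)}

lemma IsUnital.isLeftIdeal_inducedIdeal (hP : P.IsUnital) (hR : IsAlternativeRing R)
    {I : AddSubgroup R} (hI : IsLeftIdeal I) : IsLeftIdeal (P.inducedIdeal I) := by
  refine isLeftIdeal_closure ?_
  rintro c' d t r hr _ ⟨b, c, g, x, hxI, hx, rfl⟩
  by_cases hc : c = c'
  · subst hc
    obtain ⟨q, hq⟩ := hP.exists_homog_mul hR g t hr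
    obtain ⟨h1, h2⟩ := hq (𝟙 b) x hx (P.le_cod _ hx)
    rw [Category.id_comp, Category.id_comp] at h2
    rw [h2]
    exact AddSubgroup.subset_closure ⟨b, d, g ≫ t, _, hI q x hxI, h1, rfl⟩
  · rw [homog_mul_homog_of_ne hc]
    exact zero_mem _

/-- Only identities are read off: there `α_e(x) = x`, whereas a coefficient at a general `g` lies
merely in an image under `α_g`. -/
lemma coeff_mem_of_mem_inducedIdeal {I : AddSubgroup R} {s : P.SkewRing}
    (hs : s ∈ P.inducedIdeal I) (e : G) : P.coeff (𝟙 e) s ∈ I := by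
  induction hs using AddSubgroup.closure_induction with
  | mem s hs =>
    obtain ⟨b, c, g, x, hxI, hx, rfl⟩ := hs
    by_cases h : (⟨b, c, g⟩ : Quiver.Total G) = ⟨e, e, 𝟙 e⟩
    · cases h
      rw [act_id (mem_inv_id.1 hx), coeff_homog (mem_inv_id.1 hx)]
      exact hxI
    · rw [coeff_homog_of_ne h]
      exact zero_mem _
  | zero => rw [map_zero]; exact zero_mem _
  | add y z _ _ hy hz => rw [map_add]; exact add_mem hy hz
  | neg y _ hy => rw [map_neg]; exact neg_mem hy

lemma inducedIdeal_mono {I I' : AddSubgroup R} (h : I ≤ I') :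
    P.inducedIdeal I ≤ P.inducedIdeal I' :=
  AddSubgroup.closure_mono fun _ ⟨b, c, g, x, hx, hs⟩ => ⟨b, c, g, x, h hx, hs⟩

lemma IsUnital.le_of_inducedIdeal_le (hP : P.IsUnital) {I I' : AddSubgroup R}
    (hI : IsLeftIdeal I) (h : P.inducedIdeal I ≤ P.inducedIdeal I') : I ≤ I' := by
  refine hP.le_of_forall_obj hI fun e x hx hxe => ?_
  have h1 : P.homog (𝟙 e) x ∈ P.inducedIdeal I :=
    AddSubgroup.subset_closure ⟨e, e, 𝟙 e, x, hx, mem_inv_id.2 hxe, by rw [act_id hxe]⟩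
  rw [← coeff_homog hxe]
  exact coeff_mem_of_mem_inducedIdeal (h h1) e

theorem IsUnital.isLeftArtinian_base (hP : P.IsUnital) (hR : IsAlternativeRing R)
    (h : IsLeftArtinian P.SkewRing) : IsLeftArtinian R := by
  intro I hI hanti
  obtain ⟨n, hn⟩ := h (fun n => P.inducedIdeal (I n))
    (fun n => hP.isLeftIdeal_inducedIdeal hR (hI n)) (fun i j hij => inducedIdeal_mono (hanti hij))
  exact ⟨n, fun m hm => le_antisymm (hanti hm)
    (hP.le_of_inducedIdeal_le (hI n) (hn m hm).ge)⟩

/-! ### The action on blocks -/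

variable (P) in
/-- `α_g` is defined on `M` and maps it onto `N`. -/
def Moves (g : a ⟶ b) (M N : AddSubgroup R) : Prop :=
  M ≤ (P.D (Groupoid.inv g)).toAddSubgroup ∧ ∀ y, y ∈ N ↔ ∃ x ∈ M, P.act g x = y

lemma Moves.act_mem {g : a ⟶ b} {M N : AddSubgroup R} (h : P.Moves g M N) {x : R} (hx : x ∈ M) :
    P.act g x ∈ N := (h.2 _).2 ⟨x, hx, rfl⟩

lemma Moves.right_le {g : a ⟶ b} {M N : AddSubgroup R} (h : P.Moves g M N) :
    N ≤ (P.D g).toAddSubgroup := by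
  intro y hy
  obtain ⟨x, hx, rfl⟩ := (h.2 y).1 hy
  exact GroupoidPartialAction.act_mem (h.1 hx)

lemma Moves.inv {g : a ⟶ b} {M N : AddSubgroup R} (h : P.Moves g M N) :
    P.Moves (Groupoid.inv g) N M := by
  refine ⟨fun y hy => P.mem_inv_inv (h.right_le hy), fun x => ⟨fun hx => ?_, ?_⟩⟩
  · exact ⟨P.act g x, h.act_mem hx, act_inv_act (h.1 hx)⟩
  · rintro ⟨y, hy, rfl⟩
    obtain ⟨x, hx, rfl⟩ := (h.2 y).1 hy
    rwa [act_inv_act (h.1 hx)]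

lemma Moves.comp {h : a ⟶ b} {g : b ⟶ c} {L M N : AddSubgroup R} (hh : P.Moves h L M)
    (hg : P.Moves g M N) : P.Moves (h ≫ g) L N := by
  have key : ∀ x ∈ L, P.act (h ≫ g) x = P.act g (P.act h x) := fun x hx =>
    (act_act (hh.1 hx) (hg.1 (hh.act_mem hx))).symm
  refine ⟨fun x hx => mem_inv_comp (hh.1 hx) (hg.1 (hh.act_mem hx)), fun y => ⟨fun hy => ?_, ?_⟩⟩
  · obtain ⟨z, hz, rfl⟩ := (hg.2 y).1 hy
    obtain ⟨x, hx, rfl⟩ := (hh.2 z).1 hz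
    exact ⟨x, hx, key x hx⟩
  · rintro ⟨x, hx, rfl⟩
    rw [key x hx]
    exact hg.act_mem (hh.act_mem hx)

lemma Moves.id {e : G} {M : AddSubgroup R} (hM : M ≤ (P.D (𝟙 e)).toAddSubgroup) :
    P.Moves (𝟙 e) M M := by
  refine ⟨fun x hx => mem_inv_id.2 (hM hx), fun y => ⟨fun hy => ⟨y, hy, act_id (hM hy)⟩, ?_⟩⟩
  rintro ⟨x, hx, rfl⟩
  rwa [act_id (hM hx)]

lemma exists_moves {g : a ⟶ b} {N : AddSubgroup R} (hN : N ≤ (P.D g).toAddSubgroup) :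
    ∃ M, P.Moves g M N := by
  refine ⟨{ carrier := {x | x ∈ P.D (Groupoid.inv g) ∧ P.act g x ∈ N}
            add_mem' := fun {x y} hx hy => ⟨add_mem hx.1 hy.1, ?_⟩
            zero_mem' := ⟨zero_mem _, ?_⟩
            neg_mem' := fun {x} hx => ⟨neg_mem hx.1, ?_⟩ }, fun x hx => hx.1,
    fun y => ⟨fun hy => ?_, ?_⟩⟩
  · rw [act_add hx.1 hy.1]; exact add_mem hx.2 hy.2
  · rw [act_zero]; exact zero_mem _
  · rw [act_neg hx.1]; exact neg_mem hx.2
  · have h := act_act_inv (hN hy)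
    exact ⟨P.act (Groupoid.inv g) y, ⟨act_inv_mem (hN hy), by rwa [h]⟩, h⟩
  · rintro ⟨x, hx, rfl⟩
    exact hx.2

/-- A multiplier `r ∈ R` may be replaced by `r u` or `u r`, with `u` the identity of `R_g`; these
lie in `R_g` and can be pulled back along `α_g`. -/
lemma IsUnital.isUnitalIdeal_of_moves (hP : P.IsUnital) (hR : IsAlternativeRing R) {g : a ⟶ b}
    {M N : AddSubgroup R} (h : P.Moves g M N) (hM : IsUnitalIdeal M) : IsUnitalIdeal N := by
  obtain ⟨u, hu, hunit⟩ := hP.exists_unit g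
  have hD := (hP.isUnitalIdeal hR g).1
  constructor
  · intro r y hy
    obtain ⟨x, hx, rfl⟩ := (h.2 y).1 hy
    have hgx := GroupoidPartialAction.act_mem (h.1 hx)
    constructor
    · have hru := (hD r u hu).1
      rw [← hR.mul_unit_mul hD hunit r hgx, ← act_act_inv hru,
        ← act_mul (act_inv_mem hru) (h.1 hx)]
      exact h.act_mem (hM.1 _ x hx).1
    · have hru := (hD r u hu).2
      rw [← hR.mul_mul_unit hD hunit r hgx, ← act_act_inv hru,
        ← act_mul (h.1 hx) (act_inv_mem hru)]
      exact h.act_mem (hM.1 _ x hx).2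
  · obtain ⟨v, hv, hvunit⟩ := hM.2
    refine ⟨P.act g v, h.act_mem hv, fun y hy => ?_⟩
    obtain ⟨x, hx, rfl⟩ := (h.2 y).1 hy
    rw [← act_mul (h.1 hv) (h.1 hx), ← act_mul (h.1 hx) (h.1 hv), (hvunit x hx).1,
      (hvunit x hx).2]
    exact ⟨rfl, rfl⟩

lemma Moves.ne_bot {g : a ⟶ b} {M N : AddSubgroup R} (h : P.Moves g M N) (hM : M ≠ ⊥) :
    N ≠ ⊥ := by
  rintro rfl
  refine hM ((AddSubgroup.eq_bot_iff_forall _).2 fun x hx => ?_)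
  rw [← act_inv_act (h.1 hx), AddSubgroup.mem_bot.1 (h.act_mem hx), act_zero]

/-- A smaller non-zero unital ideal inside `N` pulls back to one inside `M`, so minimality is
transported. -/
lemma IsUnital.isBlock_of_moves (hP : P.IsUnital) (hR : IsAlternativeRing R) {g : a ⟶ b}
    {M N : AddSubgroup R} (h : P.Moves g M N) (hM : IsBlock M) : IsBlock N := by
  refine ⟨hP.isUnitalIdeal_of_moves hR h hM.1, h.ne_bot hM.2.1, fun C hC hCN hC0 => ?_⟩
  obtain ⟨B, hB⟩ := exists_moves (hCN.trans h.right_le)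
  have hBM : B ≤ M := fun x hx => by
    rw [← act_inv_act (hB.1 hx)]
    exact h.inv.act_mem (hCN (hB.act_mem hx))
  have hBeq := hM.2.2 B (hP.isUnitalIdeal_of_moves hR hB.inv hC) hBM (hB.inv.ne_bot hC0)
  subst hBeq
  ext y
  rw [hB.2, h.2]

lemma obj_eq_of_le {e f : G} {M : AddSubgroup R} (hM : M ≠ ⊥)
    (he : M ≤ (P.D (𝟙 e)).toAddSubgroup) (hf : M ≤ (P.D (𝟙 f)).toAddSubgroup) : e = f := by
  by_contra hne
  exact hM ((AddSubgroup.eq_bot_iff_forall _).2 fun x hx =>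
    eq_zero_of_mem_of_mem hne (he hx) (hf hx))

variable (P) in
/-- The stabilizer of `M` in the isotropy group of `e`. -/
def stabilizer {e : G} {M : AddSubgroup R} (hM : M ≤ (P.D (𝟙 e)).toAddSubgroup) :
    Subgroup (End e) where
  carrier := {h | P.Moves (a := e) (b := e) h M M}
  one_mem' := Moves.id hM
  mul_mem' := fun {_ _} hx hy => Moves.comp hy hx
  inv_mem' := fun {_} hx => Moves.inv hx

/-- If infinitely many `R_g` are non-zero, then some block has an infinite stabilizer. -/
theorem IsUnital.exists_infinite_stabilizer (hP : P.IsUnital) (hR : IsAlternativeRing R)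
    (hart : IsLeftArtinian R) (hinf : {g : Quiver.Total G | P.D g.hom ≠ ⊥}.Infinite) :
    ∃ (e : G) (M : AddSubgroup R) (hM : M ≤ (P.D (𝟙 e)).toAddSubgroup), IsBlock M ∧
      Infinite (P.stabilizer hM) := by
  have hfin := hart.finite_setOf_isBlock hR
  have hex : ∀ g : {g : Quiver.Total G | P.D g.hom ≠ ⊥}, ∃ MN :
      {M : AddSubgroup R | IsBlock M} × {M : AddSubgroup R | IsBlock M},
      P.Moves g.1.hom MN.1.1 MN.2.1 := by
    rintro ⟨⟨a, b, g⟩, hg⟩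
    obtain ⟨N, hNg, hN⟩ := hart.exists_isBlock_le (hP.isUnitalIdeal hR g) (fun h => hg (by
      ext x
      rw [NonUnitalSubring.mem_bot, ← AddSubgroup.mem_bot, ← h]
      rfl))
    obtain ⟨M, hM⟩ := exists_moves hNg
    exact ⟨⟨⟨M, hP.isBlock_of_moves hR hM.inv hN⟩, ⟨N, hN⟩⟩, hM⟩
  choose F hF using hex
  have := hinf.to_subtype
  have := hfin.to_subtype
  -- Pigeonhole over the finitely many pairs of blocks.
  obtain ⟨⟨M, N⟩, hMN⟩ := Finite.exists_infinite_fiber F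
  obtain ⟨⟨⟨⟨e, f, g₀⟩, hg₀⟩, hg₀F⟩⟩ := hMN.nonempty
  have h₀ := hF ⟨⟨e, f, g₀⟩, hg₀⟩
  rw [show F ⟨⟨e, f, g₀⟩, hg₀⟩ = (M, N) from hg₀F] at h₀
  have hMe : M.1 ≤ (P.D (𝟙 e)).toAddSubgroup := fun x hx => P.le_cod _ (h₀.1 hx)
  have hNf : N.1 ≤ (P.D (𝟙 f)).toAddSubgroup := fun x hx => P.le_cod _ (h₀.right_le hx)
  refine ⟨e, M, hMe, M.2, ?_⟩
  have hex2 : ∀ g : F ⁻¹' {(M, N)}, ∃ h : P.stabilizer hMe,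
      g.1.1 = ⟨e, f, (show e ⟶ e from h.1) ≫ g₀⟩ := by
    rintro ⟨⟨⟨a, b, g⟩, hg⟩, hgF⟩
    have h := hF ⟨⟨a, b, g⟩, hg⟩
    rw [show F ⟨⟨a, b, g⟩, hg⟩ = (M, N) from hgF] at h
    obtain rfl : a = e := obj_eq_of_le M.2.2.1 (fun x hx => P.le_cod _ (h.1 hx)) hMe
    obtain rfl : b = f := obj_eq_of_le N.2.2.1 (fun x hx => P.le_cod _ (h.right_le hx)) hNf
    -- Moving `M` to `N` by `g` and back by `g₀⁻¹` stabilizes `M`; as a non-zero block lies in only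
    -- one `R_e`, all these `g` are parallel to `g₀`.
    exact ⟨⟨g ≫ Groupoid.inv g₀, h.comp h₀.inv⟩, by simp⟩
  choose K hK using hex2
  refine Infinite.of_injective K fun g g' h => Subtype.ext (Subtype.ext ?_)
  rw [hK g, hK g', h]

end GroupoidPartialAction

/-! ### Additive maps into prime fields, and clearing denominators -/

/-- The field `k` consists of fractions of integers. -/
def IsPrimeField (k : Type*) [Field k] : Prop :=
  ∀ q : k, ∃ c z : ℤ, (c : k) ≠ 0 ∧ (c : k) * q = z

lemma isPrimeField_rat : IsPrimeField ℚ := fun q =>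
  ⟨q.den, q.num, by simp, by simp⟩

lemma isPrimeField_zmod (p : ℕ) [Fact p.Prime] : IsPrimeField (ZMod p) := fun q =>
  ⟨1, q.cast, by simp, by simp⟩

lemma exists_addMonoidHom_eq_one (k : Type*) {Q : Type*} [Field k] [AddCommGroup Q] [Module k Q]
    {q : Q} (hq : q ≠ 0) : ∃ f : Q →+ k, f q = 1 := by
  obtain ⟨f, hf⟩ : ∃ f : Module.Dual k Q, f q ≠ 0 := by
    by_contra! hc
    exact hq ((Module.forall_dual_apply_eq_zero_iff k _).1 hc)
  exact ⟨((f q)⁻¹ • f).toAddMonoidHom, inv_mul_cancel₀ hf⟩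

/-- A non-zero idempotent is detected by an additive map into a prime field. -/
lemma exists_addMonoidHom_primeField {A : Type*} [NonUnitalNonAssocRing A] {u : A} (hu : u * u = u)
    (hu0 : u ≠ 0) : ∃ (k : Type) (_ : Field k), IsPrimeField k ∧ ∃ l : A →+ k, l u = 1 := by
  by_cases hfin : addOrderOf u = 0
  · refine ⟨ℚ, inferInstance, isPrimeField_rat, ?_⟩
    have hinj : Function.Injective (zmultiplesHom A u) := by
      -- When `u` has infinite additive order, `ℤu ≅ ℤ` maps to `ℚ`, and the map extends to `A` by
      -- divisibility.
      refine (injective_iff_map_eq_zero _).2 fun m hm => ?_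
      rw [zmultiplesHom_apply] at hm
      have := addOrderOf_dvd_iff_zsmul_eq_zero.2 hm
      simpa [hfin] using this
    obtain ⟨l, hl⟩ := (Module.Baer.of_divisible ℚ).extension_property_addMonoidHom
      (zmultiplesHom A u) hinj (Int.castAddHom ℚ)
    refine ⟨l, ?_⟩
    have := DFunLike.congr_fun hl 1
    simpa using this
  · set n := addOrderOf u with hn
    have hn1 : n ≠ 1 := fun h => hu0 (AddMonoid.addOrderOf_eq_one_iff.1 h)
    obtain ⟨p, hp, m, hm⟩ := Nat.exists_prime_and_dvd hn1
    have := Fact.mk hp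
    let B : AddSubgroup A := (nsmulAddMonoidHom (α := A) p).range
    -- If `u = p r`, idempotency gives `m u = (m u)(p r) = (n u) r = 0` with `n = p m`,
    -- contradicting the order `n`. So `u` survives in the `ZMod p`-space `A / pA`.
    have huB : u ∉ B := by
      rintro ⟨r, hr⟩
      replace hr : p • r = u := hr
      have h1 : m • u = 0 := by
        calc m • u = m • (u * (p • r)) := by rw [hr, hu]
          _ = (n • u) * r := by rw [mul_smul_comm, smul_smul, smul_mul_assoc, hm, mul_comm]
          _ = 0 := by rw [addOrderOf_nsmul_eq_zero, zero_mul]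
      have h2 := addOrderOf_dvd_of_nsmul_eq_zero h1
      rw [← hn, hm] at h2
      have hm0 : 0 < m := Nat.pos_of_ne_zero (by rintro rfl; exact hfin (by simpa using hm))
      have h3 := Nat.le_of_dvd hm0 h2
      nlinarith [hp.two_le]
    let _ : Module (ZMod p) (A ⧸ B) := AddCommGroup.zmodModule (n := p) (fun x => by
      obtain ⟨x, rfl⟩ := QuotientAddGroup.mk_surjective x
      rw [← QuotientAddGroup.mk_nsmul]
      exact (QuotientAddGroup.eq_zero_iff _).2 ⟨x, rfl⟩)
    have hne : (QuotientAddGroup.mk u : A ⧸ B) ≠ 0 := fun h =>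
      huB ((QuotientAddGroup.eq_zero_iff _).1 h)
    obtain ⟨f, hf⟩ := exists_addMonoidHom_eq_one (ZMod p) hne
    exact ⟨ZMod p, inferInstance, isPrimeField_zmod p, f.comp (QuotientAddGroup.mk' B), hf⟩

namespace MonoidAlgebra

variable {k H : Type*} [Field k] [Group H]

/-- `R` is not a `k`-space, so only integral elements of the group algebra can act on it; over a
prime field every element is integral up to a non-zero scalar. -/
lemma exists_smul_eq_map_int (hk : IsPrimeField k) (y : MonoidAlgebra k H) :
    ∃ (c : ℤ) (z : MonoidAlgebra ℤ H), (c : k) ≠ 0 ∧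
      (c : k) • y = mapRingHom H (Int.castRingHom k) z := by
  induction y using MonoidAlgebra.induction_linear with
  | zero => exact ⟨1, 0, by simp, by simp⟩
  | single h q =>
    obtain ⟨c, z, hc, hz⟩ := hk q
    exact ⟨c, single h z, hc, by rw [mapRingHom_single, smul_single, smul_eq_mul, hz]; rfl⟩
  | add x y hx hy =>
    obtain ⟨c, z, hc, hz⟩ := hx
    obtain ⟨c', z', hc', hz'⟩ := hy
    refine ⟨c * c', c' • z + c • z', by simp [hc, hc'], ?_⟩
    rw [map_add, map_zsmul, map_zsmul, ← hz, ← hz', smul_add, Int.cast_mul, mul_smul, mul_smul,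
      smul_comm, Int.cast_smul_eq_zsmul, Int.cast_smul_eq_zsmul, Int.cast_smul_eq_zsmul,
      Int.cast_smul_eq_zsmul]

end MonoidAlgebra

/-! ### Left ideals of the skew ring induced from a group algebra -/

namespace GroupoidPartialAction

variable {G : Type u} [Groupoid.{v} G] {R : Type w} [NonUnitalNonAssocRing R]
variable {P : GroupoidPartialAction G R} {a b c d : G}

section Orbit

variable {e : G} {M : AddSubgroup R} {k : Type*} [Field k]

variable (P) in
/-- The additive map `∑ n_h h ↦ ∑ n_h α_g(x) δ_{gh}`. -/
noncomputable def orbitSum (H : Subgroup (End e)) {b : G} (g : e ⟶ b) (x : R) :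
    MonoidAlgebra ℤ H →+ P.SkewRing :=
  (Finsupp.liftAddHom fun h : H =>
    zmultiplesHom P.SkewRing (P.homog (End.asHom h.1 ≫ g) (P.act g x))).comp
      MonoidAlgebra.coeffAddEquiv.toAddMonoidHom

lemma orbitSum_single (H : Subgroup (End e)) {b : G} (g : e ⟶ b) (x : R) (h : H) (m : ℤ) :
    P.orbitSum H g x (MonoidAlgebra.single h m) =
      m • P.homog (End.asHom h.1 ≫ g) (P.act g x) := by
  change Finsupp.liftAddHom _ (Finsupp.single h m) = _
  rw [Finsupp.liftAddHom_apply_single]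
  rfl

variable (P) in
/-- The left ideal of the partial skew groupoid ring obtained from a left ideal of the group
algebra of a group `H` of automorphisms of `e` and a left ideal of `R`. -/
noncomputable def orbitIdeal (H : Subgroup (End e)) (M : AddSubgroup R)
    (N : Ideal (MonoidAlgebra k H)) : AddSubgroup P.SkewRing :=
  AddSubgroup.closure {s | ∃ (b : G) (g : e ⟶ b) (x : R) (n : MonoidAlgebra ℤ H), x ∈ M ∧
    x ∈ P.D (Groupoid.inv g) ∧ MonoidAlgebra.mapRingHom H (Int.castRingHom k) n ∈ N ∧
    s = P.orbitSum H g x n}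

lemma orbitIdeal_mono (H : Subgroup (End e)) (M : AddSubgroup R)
    {N N' : Ideal (MonoidAlgebra k H)} (h : N ≤ N') :
    P.orbitIdeal H M N ≤ P.orbitIdeal H M N' :=
  AddSubgroup.closure_mono fun _ ⟨b, g, x, n, hx, hxg, hn, hs⟩ => ⟨b, g, x, n, hx, hxg, h hn, hs⟩

/-- Left multiplication by `r δ_t` changes `g` to `tg` and `x` to `q x` with `q` independent of `h`,
so the group algebra element `n` is untouched. -/
lemma IsUnital.isLeftIdeal_orbitIdeal (hP : P.IsUnital) (hR : IsAlternativeRing R)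
    (H : Subgroup (End e)) (hM : IsLeftIdeal M)
    (hMH : ∀ h ∈ H, M ≤ (P.D (a := e) (b := e) h).toAddSubgroup)
    (N : Ideal (MonoidAlgebra k H)) : IsLeftIdeal (P.orbitIdeal H M N) := by
  refine isLeftIdeal_closure ?_
  rintro c' d t r hr _ ⟨c, g, x, n, hxM, hx, hn, rfl⟩
  by_cases hc : c = c'
  · subst hc
    obtain ⟨q, hq⟩ := hP.exists_homog_mul hR g t hr
    have key : ∀ n, P.homog t r * P.orbitSum H g x n = P.orbitSum H (g ≫ t) (q * x) n := by
      intro n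
      induction n using MonoidAlgebra.induction_linear with
      | zero => simp
      | add n n' hn hn' => rw [map_add, map_add, mul_add, hn, hn']
      | single h m =>
        rw [orbitSum_single, orbitSum_single, mul_smul_comm, (hq _ x hx (hMH _ h.2 hxM)).2]
    rw [key]
    exact AddSubgroup.subset_closure ⟨d, g ≫ t, _, n, hM q x hxM,
      (hq (𝟙 e) x hx (hMH _ H.one_mem hxM)).1, hn, rfl⟩
  · have key : ∀ n, P.homog t r * P.orbitSum H g x n = 0 := by
      intro n
      induction n using MonoidAlgebra.induction_linear with
      | zero => simp
      | add n n' hn hn' => rw [map_add, mul_add, hn, hn', add_zero]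
      | single h m =>
        rw [orbitSum_single, mul_smul_comm, homog_mul_homog_of_ne hc, smul_zero]
    rw [key]
    exact zero_mem _

open scoped Classical in
variable (P) in
/-- The additive map taking `∑ r_g δ_g` to `∑ l(r_h) h`, the sum over the elements of `H`. -/
noncomputable def groupAlgebraPart (H : Subgroup (End e)) (l : R →+ k) :
    P.SkewRing →+ MonoidAlgebra k H :=
  liftHomog fun g => if hg : ∃ h : H, (⟨e, e, h.1⟩ : Quiver.Total G) = g then
    (MonoidAlgebra.singleAddHom hg.choose).comp (l.comp (P.D g.hom).toAddSubgroup.subtype) else 0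

lemma groupAlgebraPart_homog (H : Subgroup (End e)) (l : R →+ k) (h : H) {x : R}
    (hx : x ∈ P.D (a := e) (b := e) h.1) :
    P.groupAlgebraPart H l (P.homog (a := e) (b := e) h.1 x) = MonoidAlgebra.single h (l x) := by
  have hex : ∃ h' : H, (⟨e, e, h'.1⟩ : Quiver.Total G) = ⟨e, e, h.1⟩ := ⟨h, rfl⟩
  rw [groupAlgebraPart, liftHomog_homog _ hx, dif_pos hex]
  have h1 : hex.choose = h := Subtype.ext (by
    simpa only [Quiver.Total.mk.injEq, heq_eq_eq, true_and] using hex.choose_spec)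
  rw [h1]
  rfl

lemma groupAlgebraPart_homog_of_ne (H : Subgroup (End e)) (l : R →+ k) {g : a ⟶ b}
    (hg : ¬∃ h : H, (⟨e, e, h.1⟩ : Quiver.Total G) = ⟨a, b, g⟩) (x : R) :
    P.groupAlgebraPart H l (P.homog g x) = 0 := by
  by_cases hx : x ∈ P.D g
  · rw [groupAlgebraPart, liftHomog_homog _ hx, dif_neg hg]
    rfl
  · rw [homog, dif_neg hx, map_zero]

lemma groupAlgebraPart_orbitSum (H : Subgroup (End e)) (l : R →+ k) (g : H) {x : R}
    (hMH : ∀ h : H, P.act (a := e) (b := e) g.1 x ∈ P.D (a := e) (b := e) h.1)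
    (n : MonoidAlgebra ℤ H) :
    P.groupAlgebraPart H l (P.orbitSum H (b := e) g.1 x n) =
      MonoidAlgebra.single g (l (P.act (a := e) (b := e) g.1 x)) *
        MonoidAlgebra.mapRingHom H (Int.castRingHom k) n := by
  induction n using MonoidAlgebra.induction_linear with
  | zero => simp
  | add n n' hn hn' => rw [map_add, map_add, map_add, mul_add, hn, hn']
  | single h m =>
    have h1 := groupAlgebraPart_homog H l (g * h) (hMH (g * h))
    rw [orbitSum_single, map_zsmul]
    refine (congrArg (m • ·) h1).trans ?_
    rw [MonoidAlgebra.mapRingHom_single, MonoidAlgebra.single_mul_single, MonoidAlgebra.smul_single,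
      zsmul_eq_mul, mul_comm, eq_intCast]

/-- For `g ∈ H` a generator maps to a left multiple of the image of `n`, which is where `N` being a
left ideal enters. For `g ∉ H` the whole coset `gH` misses `H`, and the generator maps to zero. -/
lemma groupAlgebraPart_mem {H : Subgroup (End e)} (l : R →+ k)
    (hMH : ∀ h ∈ H, P.Moves (a := e) (b := e) h M M) {N : Ideal (MonoidAlgebra k H)}
    {s : P.SkewRing} (hs : s ∈ P.orbitIdeal H M N) : P.groupAlgebraPart H l s ∈ N := by
  induction hs using AddSubgroup.closure_induction with
  | zero => rw [map_zero]; exact zero_mem _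
  | add y z _ _ hy hz => rw [map_add]; exact add_mem hy hz
  | neg y _ hy => rw [map_neg]; exact neg_mem hy
  | mem s hs =>
    obtain ⟨b, g, x, n, hxM, hxg, hn, rfl⟩ := hs
    by_cases hg : ∃ h : H, (⟨e, e, h.1⟩ : Quiver.Total G) = ⟨e, b, g⟩
    · obtain ⟨h, hh⟩ := hg
      cases hh
      rw [groupAlgebraPart_orbitSum H l h fun h' =>
        (hMH _ h'.2).right_le ((hMH _ h.2).act_mem hxM)]
      exact N.mul_mem_left _ hn
    · have key : ∀ n, P.groupAlgebraPart H l (P.orbitSum H g x n) = 0 := by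
        intro n
        induction n using MonoidAlgebra.induction_linear with
        | zero => simp
        | add n n' hn hn' => rw [map_add, map_add, hn, hn', add_zero]
        | single h m =>
          rw [orbitSum_single, map_zsmul, groupAlgebraPart_homog_of_ne, smul_zero]
          rintro ⟨h', hh'⟩
          refine hg ⟨h' * h⁻¹, ?_⟩
          obtain ⟨h', hmem⟩ := h'
          cases hh'
          congr 1
          change Groupoid.inv (show e ⟶ e from h.1) ≫ End.asHom h.1 ≫ g = g
          simp
      rw [key]
      exact zero_mem _

theorem IsUnital.isArtinianRing_monoidAlgebra (hP : P.IsUnital) (hR : IsAlternativeRing R)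
    (hS : IsLeftArtinian P.SkewRing) (H : Subgroup (End e)) (hM : IsLeftIdeal M)
    (hMH : ∀ h ∈ H, P.Moves (a := e) (b := e) h M M) (hk : IsPrimeField k) (l : R →+ k) {x : R}
    (hx : x ∈ M) (hl : l x = 1) : IsArtinianRing (MonoidAlgebra k H) := by
  have hle : ∀ h ∈ H, M ≤ (P.D (a := e) (b := e) h).toAddSubgroup :=
    fun h hh => (hMH h hh).right_le
  have hxe : x ∈ P.D (𝟙 e) := hle _ H.one_mem hx
  -- For `y ∈ N` with integral multiple `c y`, the generator of `c y` at `g = e` is sent back to `c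
  -- y` because `l x = 1`; then `c` is inverted in `k`.
  have hrec : ∀ N N' : Ideal (MonoidAlgebra k H),
      P.orbitIdeal H M N ≤ P.orbitIdeal H M N' → N ≤ N' := by
    intro N N' hNN' y hy
    obtain ⟨c, z, hc, hz⟩ := MonoidAlgebra.exists_smul_eq_map_int hk y
    have h1 : P.orbitSum H (𝟙 e) x z ∈ P.orbitIdeal H M N :=
      AddSubgroup.subset_closure ⟨e, 𝟙 e, x, z, hx, mem_inv_id.2 hxe, by
        rw [← hz]; exact N.smul_of_tower_mem (c : k) hy, rfl⟩
    have h2 := groupAlgebraPart_mem l hMH (hNN' h1)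
    have h3 := groupAlgebraPart_orbitSum (P := P) H l 1 (x := x) (fun h => by
      rw [show P.act (a := e) (b := e) (1 : H).1 x = x from act_id hxe]
      exact hle _ h.2 hx) z
    rw [show P.act (a := e) (b := e) (1 : H).1 x = x from act_id hxe, hl,
      ← MonoidAlgebra.one_def, one_mul, ← hz] at h3
    have h4 : (c : k) • y ∈ N' := by rw [← h3]; exact h2
    have h5 := N'.smul_of_tower_mem (c : k)⁻¹ h4
    rwa [smul_smul, inv_mul_cancel₀ hc, one_smul] at h5
  refine monotone_stabilizes_iff_artinian.1 fun f => ?_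
  obtain ⟨n, hn⟩ := hS (fun n => P.orbitIdeal H M (OrderDual.ofDual (f n)))
    (fun n => hP.isLeftIdeal_orbitIdeal hR H hM hle _)
    (fun i j hij => orbitIdeal_mono H M (f.monotone hij))
  exact ⟨n, fun m hm => le_antisymm (hrec _ _ (hn m hm).le) (hrec _ _ (hn m hm).ge)⟩

end Orbit

theorem IsUnital.finite_of_isLeftArtinian (hP : P.IsUnital) (hR : IsAlternativeRing R)
    (hS : IsLeftArtinian P.SkewRing) : {g : Quiver.Total G | P.D g.hom ≠ ⊥}.Finite := by
  by_contra hinf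
  obtain ⟨e, M, hM, hblock, hinfH⟩ :=
    hP.exists_infinite_stabilizer hR (hP.isLeftArtinian_base hR hS) hinf
  obtain ⟨hI, u, hu, hunit⟩ := hblock.1
  have hu0 : u ≠ 0 := by
    rintro rfl
    refine hblock.2.1 ((AddSubgroup.eq_bot_iff_forall _).2 fun x hx => ?_)
    rw [← (hunit x hx).1, zero_mul]
  obtain ⟨k, _, hk, l, hl⟩ := exists_addMonoidHom_primeField (hunit u hu).1 hu0
  have := hP.isArtinianRing_monoidAlgebra hR hS (P.stabilizer hM) hblock.1.isLeftIdeal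
    (fun h hh => hh) hk l hu hl
  have := MonoidAlgebra.finite_of_isArtinianRing (k := k) (H := P.stabilizer hM)
  exact not_finite (P.stabilizer hM)

end GroupoidPartialAction

/-! ### Descending chain conditions for groups with operators -/

section Operators

variable {Ω M M' : Type*} [AddCommGroup M] [AddCommGroup M']

/-- Descending chain condition on the subgroups of `K` that are stable under the operators `f`. -/
def IsOperatorArtinian (f : Ω → M → M) (K : AddSubgroup M) : Prop :=
  ∀ I : ℕ → AddSubgroup M, (∀ n i x, x ∈ I n → f i x ∈ I n) → (∀ n, I n ≤ K) → Antitone I →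
    ∃ n, ∀ m, n ≤ m → I m = I n

/-- The usual extension argument: `I n ⊓ K` stabilizes by the condition on `K`, and `I n ⊔ K` is
controlled by its preimage under `φ`. Operators replace module structures, which non-associativity
rules out. -/
lemma IsOperatorArtinian.sup_range {f : Ω → M →+ M} {f' : Ω → M' → M'} {K : AddSubgroup M}
    (hK : IsOperatorArtinian (fun i => f i) K) (hKf : ∀ i x, x ∈ K → f i x ∈ K)
    (h' : IsOperatorArtinian f' ⊤) (φ : M' →+ M) (hφ : ∀ i x, φ (f' i x) = f i (φ x)) :
    IsOperatorArtinian (fun i => f i) (K ⊔ φ.range) := by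
  intro I hI hIK hanti
  have hsup : ∀ n i x, x ∈ I n ⊔ K → f i x ∈ I n ⊔ K := by
    intro n i x hx
    obtain ⟨y, hy, z, hz, rfl⟩ := AddSubgroup.mem_sup.1 hx
    rw [map_add]
    exact add_mem (AddSubgroup.mem_sup_left (hI n i y hy)) (AddSubgroup.mem_sup_right (hKf i z hz))
  obtain ⟨n₁, h₁⟩ := hK (fun n => I n ⊓ K) (fun n i x hx => ⟨hI n i x hx.1, hKf i x hx.2⟩)
    (fun n => inf_le_right) (fun i j hij => inf_le_inf_right K (hanti hij))
  obtain ⟨n₂, h₂⟩ := h' (fun n => (I n ⊔ K).comap φ)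
    (fun n i x hx => by
      rw [AddSubgroup.mem_comap] at hx ⊢
      rw [hφ]; exact hsup n i _ hx)
    (fun n => le_top) (fun i j hij => AddSubgroup.comap_mono (sup_le_sup_right (hanti hij) K))
  have key : ∀ m, n₂ ≤ m → I n₂ ≤ I m ⊔ K := by
    intro m hm x hx
    obtain ⟨y, hy, _, ⟨z, rfl⟩, rfl⟩ := AddSubgroup.mem_sup.1 (hIK n₂ hx)
    have hz : z ∈ (I n₂ ⊔ K).comap φ := by
      rw [AddSubgroup.mem_comap]
      have := sub_mem (AddSubgroup.mem_sup_left (T := K) hx) (AddSubgroup.mem_sup_right hy)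
      rwa [add_sub_cancel_left] at this
    rw [← h₂ m hm] at hz
    exact add_mem (AddSubgroup.mem_sup_right hy) hz
  refine ⟨max n₁ n₂, fun m hm => ?_⟩
  have hm₁ := (le_max_left _ _).trans hm
  have hm₂ := (le_max_right _ _).trans hm
  -- Modular law: nested subgroups with the same meet and join with `K` coincide.
  refine eq_of_le_of_inf_le_of_sup_le (z := K) (hanti hm) ?_ ?_
  · rw [h₁ m hm₁, ← h₁ _ (le_max_left n₁ n₂)]
  · exact sup_le ((hanti (le_max_right _ _)).trans (key m hm₂)) le_sup_right

lemma IsOperatorArtinian.iSup_range {ι : Type*} {N : ι → Type*} [∀ j, AddCommGroup (N j)]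
    {f : Ω → M →+ M} {f' : ∀ j, Ω → N j → N j} (s : Finset ι)
    (h' : ∀ j ∈ s, IsOperatorArtinian (f' j) ⊤) (φ : ∀ j, N j →+ M)
    (hφ : ∀ j i x, φ j (f' j i x) = f i (φ j x)) :
    IsOperatorArtinian (fun i => f i) (⨆ j ∈ s, (φ j).range) := by
  classical
  induction s using Finset.induction_on with
  | empty =>
    intro I _ hI0 _
    simp only [Finset.notMem_empty, iSup_false, iSup_bot, le_bot_iff] at hI0
    exact ⟨0, fun m _ => (hI0 m).trans (hI0 0).symm⟩
  | insert j s hj ih =>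
    rw [Finset.iSup_insert, sup_comm]
    refine (ih fun j' hj' => h' j' (Finset.mem_insert_of_mem hj')).sup_range ?_
      (h' j (Finset.mem_insert_self j s)) (φ j) (hφ j)
    intro i x hx
    have : (⨆ j ∈ s, (φ j).range) ≤ (⨆ j ∈ s, (φ j).range).comap (f i) := by
      refine iSup₂_le fun j hj => ?_
      rintro _ ⟨y, rfl⟩
      rw [AddSubgroup.mem_comap, ← hφ]
      exact AddSubgroup.mem_iSup_of_mem j (AddSubgroup.mem_iSup_of_mem hj ⟨_, rfl⟩)
    exact this hx

end Operators

/-- An additive anti-isomorphism exchanges the two chain conditions. -/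
lemma isRightArtinian_iff_of_antiEquiv {A B : Type*} [NonUnitalNonAssocRing A]
    [NonUnitalNonAssocRing B] (φ : A ≃+ B) (hφ : ∀ x y, φ (x * y) = φ y * φ x) :
    IsRightArtinian A ↔ IsLeftArtinian B := by
  have hφ' : ∀ x y, φ.symm (x * y) = φ.symm y * φ.symm x := fun x y => by
    apply φ.injective; rw [hφ]; simp
  constructor
  · intro h I hI hanti
    obtain ⟨n, hn⟩ := h (fun n => (I n).comap φ.toAddMonoidHom)
      (fun n a x hx => by
        change φ (x * a) ∈ I n
        rw [hφ]; exact hI n _ _ hx)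
      (fun i j hij => AddSubgroup.comap_mono (hanti hij))
    exact ⟨n, fun m hm => AddSubgroup.comap_injective (f := φ.toAddMonoidHom) φ.surjective (hn m hm)⟩
  · intro h I hI hanti
    obtain ⟨n, hn⟩ := h (fun n => (I n).comap φ.symm.toAddMonoidHom)
      (fun n a x hx => by
        change φ.symm (a * x) ∈ I n
        rw [hφ']; exact hI n _ _ hx)
      (fun i j hij => AddSubgroup.comap_mono (hanti hij))
    exact ⟨n, fun m hm =>
      AddSubgroup.comap_injective (f := φ.symm.toAddMonoidHom) φ.symm.surjective (hn m hm)⟩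

/-! ### Sufficiency: finite sums of the `R_g δ_g` -/

namespace GroupoidPartialAction

variable {G : Type u} [Groupoid.{v} G] {R : Type w} [NonUnitalNonAssocRing R]
variable {P : GroupoidPartialAction G R} {a b c d : G}

/-- This also covers `e ≠ c(g)`: then `r x` lies in two different summands of `R` and vanishes too.
-/
lemma homog_id_mul_homog {e : G} {g : a ⟶ b} {r x : R} (hr : r ∈ P.D (𝟙 e)) (hx : x ∈ P.D g) :
    P.homog (𝟙 e) r * P.homog g x = P.homog g (r * x) := by
  by_cases h : b = e
  · subst h
    have hr' : P.act (Groupoid.inv (𝟙 b)) r = r := by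
      rw [show Groupoid.inv (𝟙 b) = 𝟙 b by simp, act_id hr]
    rw [homog_mul_homog hr hx, hr', Category.comp_id, act_id (P.ideal_obj b x r hr).2]
  · rw [homog_mul_homog_of_ne h]
    have h0 : r * x = 0 := eq_zero_of_mem_of_mem h (P.ideal_obj b r x (P.le_cod g hx)).1
      (P.ideal_obj e x r hr).2
    rw [h0, homog_zero]

theorem IsUnital.isLeftArtinian_skewRing (hP : P.IsUnital) (hR : IsAlternativeRing R)
    (hart : IsLeftArtinian R) (hfin : {g : Quiver.Total G | P.D g.hom ≠ ⊥}.Finite) :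
    IsLeftArtinian P.SkewRing := by
  let f : (Σ e : G, P.D (𝟙 e)) → P.SkewRing →+ P.SkewRing :=
    fun i => AddMonoidHom.mulLeft (P.homog (𝟙 i.1) i.2)
  have hD {a b : G} (g : a ⟶ b) := (hP.isUnitalIdeal hR g).1
  let f' : ∀ g : Quiver.Total G, (Σ e : G, P.D (𝟙 e)) → P.D g.hom → P.D g.hom :=
    fun g i x => ⟨i.2 * x, (hD g.hom i.2 x x.2).1⟩
  have hf' : ∀ g, IsOperatorArtinian (f' g) ⊤ := by
    intro g I hI _ hanti
    let ι : P.D g.hom →+ R := (P.D g.hom).toAddSubgroup.subtype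
    obtain ⟨n, hn⟩ := hart (fun n => (I n).map ι) (fun n r x hx => by
        obtain ⟨x, hx, rfl⟩ := hx
        -- The operators come only from the `R_e`, but these generate `R` additively, so stability
        -- under them gives a left ideal of `R`.
        refine mem_of_forall_mem_obj (P := P)
          (I := ((I n).map ι).comap (AddMonoidHom.mulRight (ι x))) (fun e r hr => ?_) r
        exact ⟨_, hI n ⟨e, r, hr⟩ x hx, rfl⟩)
      (fun i j hij => AddSubgroup.map_mono (hanti hij))
    exact ⟨n, fun m hm => AddSubgroup.map_injective (f := ι) Subtype.val_injective (hn m hm)⟩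
  have hS := IsOperatorArtinian.iSup_range (f := f) (f' := f') hfin.toFinset
    (fun g _ => hf' g) (fun g => P.δ g.hom) (by
      rintro g ⟨e, r⟩ x
      have h := homog_id_mul_homog r.2 x.2
      rw [homog_of_mem x.2, homog_of_mem (hD g.hom r x x.2).1] at h
      exact h.symm)
  intro I hI hanti
  refine hS I (fun n i x hx => hI n _ x hx) (fun n s hs => ?_) hanti
  clear hs
  induction s using SkewRing.induction with
  | zero => exact zero_mem _
  | add s t hs ht => exact add_mem hs ht
  | homog g x hx =>
    by_cases hg : P.D g = ⊥
    · rw [hg, NonUnitalSubring.mem_bot] at hx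
      rw [hx, homog_zero]
      exact zero_mem _
    · refine AddSubgroup.mem_iSup_of_mem ⟨_, _, g⟩
        (AddSubgroup.mem_iSup_of_mem (hfin.mem_toFinset.2 hg) ⟨⟨x, hx⟩, ?_⟩)
      rw [homog_of_mem hx]

theorem IsUnital.isLeftArtinian_iff (hP : P.IsUnital) (hR : IsAlternativeRing R) :
    IsLeftArtinian P.SkewRing ↔
      IsLeftArtinian R ∧ {g : Quiver.Total G | P.D g.hom ≠ ⊥}.Finite :=
  ⟨fun h => ⟨hP.isLeftArtinian_base hR h, hP.finite_of_isLeftArtinian hR h⟩,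
    fun h => hP.isLeftArtinian_skewRing hR h.1 h.2⟩

end GroupoidPartialAction

/-! ### The opposite partial action -/

open MulOpposite

lemma IsAlternativeRing.mulOpposite {A : Type*} [NonUnitalNonAssocRing A]
    (hA : IsAlternativeRing A) : IsAlternativeRing Aᵐᵒᵖ := fun x y =>
  ⟨unop_injective (hA (unop y) (unop x)).2, unop_injective (hA (unop y) (unop x)).1⟩

/-- The opposite of a non-unital subring. -/
def NonUnitalSubring.opposite {A : Type*} [NonUnitalNonAssocRing A] (S : NonUnitalSubring A) :
    NonUnitalSubring Aᵐᵒᵖ where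
  carrier := {x | unop x ∈ S}
  add_mem' := fun hx hy => S.add_mem hx hy
  zero_mem' := S.zero_mem
  neg_mem' := fun hx => S.neg_mem hx
  mul_mem' := fun hx hy => S.mul_mem hy hx

namespace GroupoidPartialAction

variable {G : Type u} [Groupoid.{v} G] {R : Type w} [NonUnitalNonAssocRing R]

lemma isInternal_opposite {ι : Type*} [DecidableEq ι] {D : ι → NonUnitalSubring R}
    (h : DirectSum.IsInternal D) : DirectSum.IsInternal fun i => (D i).opposite := by
  let ψ : DirectSum ι (fun i => (D i).opposite) ≃+ DirectSum ι (fun i => D i) :=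
    DFinsupp.mapRange.addEquiv fun i =>
      { toFun := fun x => ⟨unop x.1, x.2⟩
        invFun := fun x => ⟨op x.1, x.2⟩
        left_inv := fun _ => rfl
        right_inv := fun _ => rfl
        map_add' := fun _ _ => rfl }
  have key : ∀ z, DirectSum.coeAddMonoidHom (fun i => (D i).opposite) z =
      op (DirectSum.coeAddMonoidHom D (ψ z)) := by
    intro z
    induction z using DirectSum.induction_on with
    | zero => simp
    | add y z hy hz => rw [map_add, map_add, map_add, hy, hz]; rfl
    | of i x =>
      have hψ : ψ (DirectSum.of _ i x) = DirectSum.of (fun i => D i) i ⟨unop x.1, x.2⟩ :=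
        DFinsupp.mapRange_single (hf := fun _ => rfl)
      rw [hψ, DirectSum.coeAddMonoidHom_of, DirectSum.coeAddMonoidHom_of, op_unop]
  have : ⇑(DirectSum.coeAddMonoidHom fun i => (D i).opposite) =
      op ∘ DirectSum.coeAddMonoidHom D ∘ ψ := funext key
  change Function.Bijective _
  rw [this]
  exact opEquiv.bijective.comp (h.comp ψ.bijective)

variable (P : GroupoidPartialAction G R)

/-- The partial action on the opposite ring. -/
def opposite : GroupoidPartialAction G Rᵐᵒᵖ where
  D g := (P.D g).opposite
  α g :=
    { toFun := fun x => ⟨op (P.α g ⟨unop x.1, x.2⟩ : R), (P.α g ⟨unop x.1, x.2⟩).2⟩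
      invFun := fun x => ⟨op ((P.α g).symm ⟨unop x.1, x.2⟩ : R),
        ((P.α g).symm ⟨unop x.1, x.2⟩).2⟩
      left_inv := fun x => Subtype.ext (congrArg (fun y : P.D (Groupoid.inv g) => op (y : R))
        ((P.α g).symm_apply_apply ⟨unop x.1, x.2⟩))
      right_inv := fun x => Subtype.ext (congrArg (fun y : P.D g => op (y : R))
        ((P.α g).apply_symm_apply ⟨unop x.1, x.2⟩))
      map_mul' := fun x y => Subtype.ext (congrArg (fun y : P.D g => op (y : R))
        (map_mul (P.α g) ⟨unop y.1, y.2⟩ ⟨unop x.1, x.2⟩))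
      map_add' := fun x y => Subtype.ext (congrArg (fun y : P.D g => op (y : R))
        (map_add (P.α g) ⟨unop x.1, x.2⟩ ⟨unop y.1, y.2⟩)) }
  ideal_obj e r x hx := (P.ideal_obj e (unop r) (unop x) hx).symm
  le_cod g x hx := P.le_cod g (x := unop x) hx
  ideal_cod g r x hr hx := (P.ideal_cod g (unop r) (unop x) hr hx).symm
  map_id e x := congrArg op (P.map_id e ⟨unop x.1, x.2⟩)
  dom_comp h g x hx := P.dom_comp h g ⟨unop x.1, x.2⟩ hx
  map_comp h g x hx := congrArg op (P.map_comp h g ⟨unop x.1, x.2⟩ hx)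
  isInternal := by classical exact isInternal_opposite P.isInternal

variable {P} {a b c d : G}

lemma mem_opposite_D {g : a ⟶ b} {x : R} : op x ∈ P.opposite.D g ↔ x ∈ P.D g := Iff.rfl

lemma opposite_D_eq_bot {g : a ⟶ b} : P.opposite.D g = ⊥ ↔ P.D g = ⊥ := by
  constructor
  · intro h
    refine eq_bot_iff.2 fun x hx => NonUnitalSubring.mem_bot.2 ?_
    have : op x ∈ P.opposite.D g := hx
    rw [h, NonUnitalSubring.mem_bot] at this
    exact op_injective this
  · intro h
    refine eq_bot_iff.2 fun x hx => NonUnitalSubring.mem_bot.2 ?_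
    have : unop x ∈ P.D g := hx
    rw [h, NonUnitalSubring.mem_bot] at this
    exact unop_injective this

lemma IsUnital.opposite (hP : P.IsUnital) : P.opposite.IsUnital := by
  intro a b g hg
  obtain ⟨u, hu, hunit⟩ := hP g fun h => hg (opposite_D_eq_bot.2 h)
  exact ⟨op u, hu, fun x hx => ⟨unop_injective (hunit (unop x) hx).2,
    unop_injective (hunit (unop x) hx).1⟩⟩

lemma opposite_act {g : a ⟶ b} (x : R) : P.opposite.act g (op x) = op (P.act g x) := by
  by_cases hx : x ∈ P.D (Groupoid.inv g)
  · rw [act_of_mem hx, act_of_mem (mem_opposite_D.2 hx)]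
    rfl
  · rw [act, act, dif_neg hx, dif_neg (fun h => hx (mem_opposite_D.1 h)), op_zero]

lemma groupoid_inv_inv (g : a ⟶ b) : Groupoid.inv (Groupoid.inv g) = g := by simp

lemma groupoid_inv_comp (h : a ⟶ b) (g : b ⟶ c) :
    Groupoid.inv (h ≫ g) = Groupoid.inv g ≫ Groupoid.inv h := by simp

variable (P) in
/-- The additive map `r δ_g ↦ α_{g⁻¹}(r) δ_{g⁻¹}` to the skew ring of the opposite action. -/
noncomputable def toOpposite : P.SkewRing →+ P.opposite.SkewRing :=
  liftHomog fun g => AddMonoidHom.mk'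
    (fun x => P.opposite.homog (Groupoid.inv g.hom) (op (P.act (Groupoid.inv g.hom) x)))
    fun x y => by
      change P.opposite.homog _ (op (P.act _ (x.1 + y.1))) = _
      rw [act_add (P.mem_inv_inv x.2) (P.mem_inv_inv y.2), MulOpposite.op_add,
        homog_add (mem_opposite_D.2 (act_inv_mem x.2)) (mem_opposite_D.2 (act_inv_mem y.2))]

variable (P) in
/-- The inverse of `toOpposite`. -/
noncomputable def ofOpposite : P.opposite.SkewRing →+ P.SkewRing :=
  liftHomog fun g => AddMonoidHom.mk'
    (fun x => P.homog (Groupoid.inv g.hom) (P.act (Groupoid.inv g.hom) (unop x.1)))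
    fun x y => by
      have hx : unop x.1 ∈ P.D g.hom := x.2
      have hy : unop y.1 ∈ P.D g.hom := y.2
      change P.homog _ (P.act _ (unop x.1 + unop y.1)) = _
      rw [act_add (P.mem_inv_inv hx) (P.mem_inv_inv hy),
        homog_add (act_inv_mem hx) (act_inv_mem hy)]

lemma toOpposite_homog {g : a ⟶ b} {x : R} (hx : x ∈ P.D g) :
    P.toOpposite (P.homog g x) =
      P.opposite.homog (Groupoid.inv g) (op (P.act (Groupoid.inv g) x)) :=
  liftHomog_homog _ hx

lemma ofOpposite_homog {g : a ⟶ b} {x : R} (hx : x ∈ P.D g) :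
    P.ofOpposite (P.opposite.homog g (op x)) =
      P.homog (Groupoid.inv g) (P.act (Groupoid.inv g) x) :=
  liftHomog_homog _ (mem_opposite_D.2 hx)

/-- With `w = α_{g⁻¹}(r) s`, both sides at `r δ_g` and `s δ_h` have coefficient `α_{h⁻¹}(w)`: on the
left because `α_{(gh)⁻¹}(α_g(w)) = α_{h⁻¹}(w)`, on the right because the opposite product restores
the order of the factors. -/
lemma toOpposite_mul (s t : P.SkewRing) :
    P.toOpposite (s * t) = P.toOpposite t * P.toOpposite s := by
  induction s using SkewRing.induction with
  | zero => simp
  | add s s' hs hs' => rw [add_mul, map_add, map_add, mul_add, hs, hs']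
  | @homog b c g x hx =>
    induction t using SkewRing.induction with
    | zero => simp
    | add t t' ht ht' => rw [mul_add, map_add, map_add, add_mul, ht, ht']
    | @homog a b' h y hy =>
      by_cases hb : b' = b
      · subst hb
        have hx' := act_inv_mem hx
        have hy' := act_inv_mem hy
        have hw : P.act (Groupoid.inv g) x * y ∈ P.D (Groupoid.inv g) :=
          (P.ideal_cod _ _ _ (P.le_cod h hy) hx').2
        have hwh : P.act (Groupoid.inv g) x * y ∈ P.D h :=
          (P.ideal_cod _ _ _ (P.le_cod _ hx') hy).1
        have hz := act_mem_comp hw hwh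
        rw [homog_mul_homog hx hy, toOpposite_homog hz, toOpposite_homog hx, toOpposite_homog hy,
          homog_mul_homog (mem_opposite_D.2 hy') (mem_opposite_D.2 hx'), opposite_act,
          ← op_mul, opposite_act, groupoid_inv_inv, act_act_inv hy, groupoid_inv_comp h g,
          ← act_act (P.mem_inv_inv (act_mem hw)), act_inv_act hw]
        rw [act_inv_act hw]
        exact P.mem_inv_inv hwh
      · rw [homog_mul_homog_of_ne hb, toOpposite_homog hx, toOpposite_homog hy,
          homog_mul_homog_of_ne (Ne.symm hb), map_zero]

variable (P) in
/-- The skew ring of the opposite action is the opposite of the skew ring. -/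
noncomputable def oppositeEquiv : P.SkewRing ≃+ P.opposite.SkewRing where
  toFun := P.toOpposite
  invFun := P.ofOpposite
  left_inv s := by
    induction s using SkewRing.induction with
    | zero => simp
    | add s t hs ht => rw [map_add, map_add, hs, ht]
    | homog g x hx =>
      rw [toOpposite_homog hx, ofOpposite_homog (act_inv_mem hx), groupoid_inv_inv,
        act_act_inv hx]
  right_inv s := by
    induction s using SkewRing.induction with
    | zero => simp
    | add s t hs ht => rw [map_add, map_add, hs, ht]
    | homog g x hx =>
      have hx' : unop x ∈ P.D g := hx
      rw [← op_unop x, ofOpposite_homog hx', toOpposite_homog (act_inv_mem hx'),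
        groupoid_inv_inv, act_act_inv hx']
  map_add' := map_add _

theorem IsUnital.isRightArtinian_iff (hP : P.IsUnital) (hR : IsAlternativeRing R) :
    IsRightArtinian P.SkewRing ↔
      IsRightArtinian R ∧ {g : Quiver.Total G | P.D g.hom ≠ ⊥}.Finite := by
  rw [isRightArtinian_iff_of_antiEquiv P.oppositeEquiv toOpposite_mul,
    isRightArtinian_iff_of_antiEquiv (opAddEquiv (α := R)) fun _ _ => rfl,
    IsUnital.isLeftArtinian_iff hP.opposite hR.mulOpposite]
  simp only [ne_eq, opposite_D_eq_bot]

end GroupoidPartialAction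

theorem theorem1p3 {G : Type u} [CategoryTheory.Groupoid.{v} G]
    {R : Type w} [NonUnitalNonAssocRing R] (hR : IsAlternativeRing R)
    (P : GroupoidPartialAction G R) (hP : P.IsUnital) :
    (IsLeftArtinian P.SkewRing ↔
      IsLeftArtinian R ∧ {g : Quiver.Total G | P.D g.hom ≠ ⊥}.Finite) ∧
    (IsRightArtinian P.SkewRing ↔
      IsRightArtinian R ∧ {g : Quiver.Total G | P.D g.hom ≠ ⊥}.Finite) :=
  ⟨hP.isLeftArtinian_iff hR, hP.isRightArtinian_iff hR⟩
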